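/- Let $A\in\mathbb R^{n\times n}$ and $b,c\in\mathbb R^n$ with $(A,b)$ controllable, let $\Omega\subset\mathbb R^n$ be compact and convex, $\theta\in\Omega$, $x_0\in\mathbb R^n$, and let $r:[0,\infty)\to\mathbb R$ be bounded and continuous. Let $K\in\mathbb R^n$ be such that $A_m=A-bK^\top$ is Hurwitz, put $H_o(s)=(sI-A_m)^{-1}b$, assume $c^\top H_o(0)\neq0$ and put $k_g=1/(c^\top H_o(0))$. Let $C(s)$ be a stable strictly proper rational transfer function with real coefficients and $C(0)=1$, let $Q$ be symmetric positive definite, let $P$ solve $A_m^\top P+PA_m=-Q$, let $\Gamma_c>0$ and $\hat\theta_0\in\Omega$. For $z\in\Omega$ and $y\in\mathbb R^n$ let $\mathrm{Proj}(z,y)$ be the Euclidean projection of $y$ onto the tangent cone of $\Omega$ at $z$. Consider a trajectory on $[0,\infty)$ of the uncertain system $$\dot x=Ax+b(u-\theta^\top x),\qquad x(0)=x_0,$$ with the $\mathcal L_1$ adaptive controller: the control $u=-K^\top x+u_2$, the state predictor $$\dot{\hat x}=A_m\hat x-b\,\hat\theta^\top x+b\,u_2,\qquad \hat x(0)=x_0,$$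 the adaptive law $$\dot{\hat\theta}=\Gamma_c\,\mathrm{Proj}\big(\hat\theta,\;x\,\tilde x^\top Pb\big),\qquad \hat\theta(0)=\hat\theta_0,\qquad \tilde x=\hat x-x$$ (in the sense of Carathéodory: $\hat\theta$ is locally absolutely continuous and the equation holds for almost every $t$), and the filtered signal $u_2(s)=C(s)\big(\bar r(s)+k_g r(s)\big)$ with $\bar r=\hat\theta^\top x$, that is, $u_2$ is the convolution on $[0,t]$ of the impulse response of $C$ with $\bar r+k_g r$. Let $\bar G(s)=H_o(s)\,(C(s)-1)$, let $\|\bar G\|_{\mathcal L_1}=\max_i\int_0^\infty|\bar g_i(t)|\,dt$, where $\bar g_i$ is the impulse response of the $i$-th entry of $\bar G$, and let $\theta_{\max}=\max_{z\in\Omega}\sum_{i=1}^n|z_i|$. If the $\mathcal L_1$-gain requirement $$\|\bar G\|_{\mathcal L_1}\,\theta_{\max}<1$$ holds, then $\hat x$ and $x$ are bounded on $[0,\infty)$ and $\lim_{t\to\infty}\tilde x(t)=0$. -/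

import Mathlib

open MeasureTheory

noncomputable section

namespace L1Adaptive

/-! ### Linear systems and transfer functions -/

/-- All eigenvalues of the real matrix `M` have negative real part. -/
def IsHurwitz {n : ℕ} (M : Matrix (Fin n) (Fin n) ℝ) : Prop :=
  ∀ z ∈ spectrum ℂ (M.map (algebraMap ℝ ℂ)), z.re < 0

/-- Kalman's criterion: `b, A b, …, A ^ (n - 1) b` span the state space. -/
def IsControllable {n : ℕ} (A : Matrix (Fin n) (Fin n) ℝ) (b : Fin n → ℝ) : Prop :=
  Submodule.span ℝ (Set.range fun k : Fin n => (A ^ (k : ℕ)).mulVec b) = ⊤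

/-- A rational transfer function is stable: all its poles lie in the open left half plane. -/
def IsStable (H : RatFunc ℝ) : Prop :=
  ∀ z : ℂ, H.denom.eval₂ (algebraMap ℝ ℂ) z = 0 → z.re < 0

/-- The denominator has larger degree than the numerator. -/
def IsStrictlyProper (H : RatFunc ℝ) : Prop :=
  H.num.degree < H.denom.degree

/-- `h` is the impulse response of the strictly proper transfer function `H`: it is continuous
on `[0, ∞)` and its Laplace transform is `H` on some right half plane. These conditions determine
`h` on `[0, ∞)`. -/
def IsImpulseResponse (h : ℝ → ℝ) (H : RatFunc ℝ) : Prop :=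
  ContinuousOn h (Set.Ici 0) ∧
    ∃ σ : ℝ, ∀ s : ℂ, σ < s.re →
      IntegrableOn (fun t : ℝ => Complex.exp (-(s * t)) * (h t : ℂ)) (Set.Ioi 0) ∧
      ∫ t in Set.Ioi (0 : ℝ), Complex.exp (-(s * t)) * (h t : ℂ) =
        H.eval (algebraMap ℝ ℂ) s

open Classical in
/-- The impulse response of a strictly proper transfer function (zero by convention if
there is none, which happens only for transfer functions that are not strictly proper). -/
def impulseResponse (H : RatFunc ℝ) : ℝ → ℝ :=
  if h : ∃ f : ℝ → ℝ, IsImpulseResponse f H then h.choose else 0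

/-- The zero-state response at time `t` of the strictly proper system `H` to the input `v`, that
is, the time-domain meaning of `y(s) = H(s) v(s)`. -/
def response (H : RatFunc ℝ) (v : ℝ → ℝ) (t : ℝ) : ℝ :=
  ∫ τ in (0 : ℝ)..t, impulseResponse H (t - τ) * v τ

/-- The `L₁` gain `max_i ∑_j ∫₀^∞ |h_ij(t)| dt` of a strictly proper system with `m` inputs and
`n` outputs. -/
def l1Gain {n m : ℕ} (H : Matrix (Fin n) (Fin m) (RatFunc ℝ)) : ENNReal :=
  ⨆ i, ∑ j, ∫⁻ t in Set.Ioi (0 : ℝ), ENNReal.ofReal |impulseResponse (H i j) t|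

/-- `H_o(s) = (s I - A_m)⁻¹ b`. -/
def Ho {n : ℕ} (Am : Matrix (Fin n) (Fin n) ℝ) (b : Fin n → ℝ) : Fin n → RatFunc ℝ :=
  (Matrix.scalar (Fin n) (RatFunc.X : RatFunc ℝ) - Am.map RatFunc.C)⁻¹.mulVec
    (fun i => RatFunc.C (b i))

/-- `Ḡ(s) = H_o(s) (C(s) - 1)`, a system with one input and `n` outputs. -/
def Gbar {n : ℕ} (Am : Matrix (Fin n) (Fin n) ℝ) (b : Fin n → ℝ) (C : RatFunc ℝ) :
    Matrix (Fin n) (Fin 1) (RatFunc ℝ) :=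
  Matrix.of fun i _ => Ho Am b i * (C - 1)

/-- The value `cᵀ H_o(0)`. -/
def dcGain {n : ℕ} (Am : Matrix (Fin n) (Fin n) ℝ) (b c : Fin n → ℝ) : ℝ :=
  (∑ i, RatFunc.C (c i) * Ho Am b i).eval (RingHom.id ℝ) 0

/-- `A_m = A - b Kᵀ`. -/
def closedMatrix {n : ℕ} (A : Matrix (Fin n) (Fin n) ℝ) (b K : Fin n → ℝ) :
    Matrix (Fin n) (Fin n) ℝ :=
  A - Matrix.vecMulVec b K

/-! ### Parameter set and projection -/

/-- `θ_max = max_{θ ∈ Ω} ∑ i, |θ_i|`. -/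
def thetaMax {n : ℕ} (Ω : Set (Fin n → ℝ)) : ℝ :=
  sSup ((fun z : Fin n → ℝ => ∑ i, |z i|) '' Ω)

/-- The tangent cone of the convex set `Ω` at `z`. -/
def tangentCone {n : ℕ} (Ω : Set (Fin n → ℝ)) (z : Fin n → ℝ) : Set (Fin n → ℝ) :=
  closure {v | ∃ s : ℝ, 0 ≤ s ∧ ∃ w ∈ Ω, v = s • (w - z)}

/-- `v = Proj(z, y)`: `v` is the Euclidean projection of the direction `y` onto the tangent cone
of `Ω` at `z`. Hence `Proj(z, y) = y` at interior points of `Ω`, and, at a point with a smooth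
boundary, `Proj(z, y)` is `y` without its outward normal component. -/
def IsProj {n : ℕ} (Ω : Set (Fin n → ℝ)) (z y v : Fin n → ℝ) : Prop :=
  v ∈ tangentCone Ω z ∧
    ∀ w ∈ tangentCone Ω z, ∑ i, (y i - v i) ^ 2 ≤ ∑ i, (y i - w i) ^ 2

/-! ### The closed loop -/

/-- The signals `x`, `xhat`, `θhat`, `u` form a trajectory on `[0, ∞)` of the uncertain system
with the `L₁` adaptive controller. The adaptive law has a discontinuous right-hand side and is
understood in the sense of Carathéodory, that is, in integrated form. -/
structure IsTrajectory {n : ℕ} (A : Matrix (Fin n) (Fin n) ℝ) (b c K : Fin n → ℝ)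
    (C : RatFunc ℝ) (P : Matrix (Fin n) (Fin n) ℝ) (Γc : ℝ) (Ω : Set (Fin n → ℝ))
    (θ : Fin n → ℝ) (r : ℝ → ℝ) (x₀ θhat₀ : Fin n → ℝ)
    (x xhat θhat : ℝ → Fin n → ℝ) (u u₁ u₂ : ℝ → ℝ) : Prop where
  /-- the plant -/
  x_zero : x 0 = x₀
  x_deriv : ∀ t, 0 ≤ t →
    HasDerivWithinAt x (A.mulVec (x t) + (u t - θ ⬝ᵥ x t) • b) (Set.Ici 0) t
  /-- the control signal -/
  control : ∀ t, 0 ≤ t → u t = u₁ t + u₂ t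
  control_one : ∀ t, 0 ≤ t → u₁ t = -(K ⬝ᵥ x t)
  control_two : ∀ t, 0 ≤ t →
    u₂ t = response C
      (fun τ => θhat τ ⬝ᵥ x τ + 1 / dcGain (closedMatrix A b K) b c * r τ) t
  /-- the state predictor -/
  xhat_zero : xhat 0 = x₀
  xhat_deriv : ∀ t, 0 ≤ t →
    HasDerivWithinAt xhat
      ((closedMatrix A b K).mulVec (xhat t) - (θhat t ⬝ᵥ x t) • b + u₂ t • b) (Set.Ici 0) t
  /-- the adaptive law -/
  θhat_law : ∃ v : ℝ → Fin n → ℝ,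
    (∀ T, 0 ≤ T → IntegrableOn v (Set.Icc 0 T)) ∧
    (∀ᵐ t ∂(volume.restrict (Set.Ici (0 : ℝ))),
      IsProj Ω (θhat t) (((xhat t - x t) ⬝ᵥ P.mulVec b) • x t) (v t)) ∧
    ∀ t, 0 ≤ t → θhat t = θhat₀ + Γc • ∫ τ in (0 : ℝ)..t, v τ

end L1Adaptive

end

/-!
With `e = xhat - x` and `δ = θhat - θ`, the function `V = eᵀ P e + δᵀ δ / Γc` satisfies
`V' ≤ -eᵀ Q e`: the adaptive law cancels the terms linear in `δ`, and the projection keeps `θhat`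
in `Ω` and only decreases `V`. Hence `e` is bounded and square integrable, whatever `x` does. The
predictor is the sum of a decaying free motion, the bounded response of `H_o C` to the reference,
and the response of `Ḡ` to `θhatᵀ x`, where `x = xhat - e`. As the loop through `Ḡ` has gain at
most `‖Ḡ‖_{L₁} θ_max < 1`, the small gain argument bounds `xhat`, hence `x` and the derivative
of `e`; a square integrable signal with bounded derivative tends to zero.
-/

noncomputable section

namespace L1Adaptive

open Set Filter Topology
open scoped Matrix

/-! ### Convolution of causal signals -/

lemma exists_continuous_eqOn_Ici {E : Type*} [TopologicalSpace E] {f : ℝ → E} {a : ℝ}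
    (hf : ContinuousOn f (Ici a)) : ∃ g : ℝ → E, Continuous g ∧ EqOn f g (Ici a) :=
  ⟨fun t => f (max t a), hf.comp_continuous (by fun_prop) fun _ => mem_Ici.2 (le_max_right _ _),
    fun t ht => by simp [max_eq_left (mem_Ici.1 ht)]⟩

lemma intervalIntegral_swap_triangle {E : Type*} [NormedAddCommGroup E] [NormedSpace ℝ E]
    {G : ℝ → ℝ → E} {a b : ℝ} (hab : a ≤ b)
    (hG : IntegrableOn (Function.uncurry G) (Ioc a b ×ˢ Ioc a b)) :
    ∫ τ in a..b, ∫ σ in a..τ, G τ σ = ∫ σ in a..b, ∫ τ in σ..b, G τ σ := by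
  let F : ℝ → ℝ → E := fun τ σ => {p : ℝ × ℝ | p.2 ≤ p.1}.indicator (Function.uncurry G) (τ, σ)
  have hF : IntegrableOn (Function.uncurry F) (uIoc a b ×ˢ uIoc a b) := by
    rw [uIoc_of_le hab]
    exact hG.indicator (isClosed_le continuous_snd continuous_fst).measurableSet
  have inner_left : ∀ τ ∈ Ioc a b, ∫ σ in a..b, F τ σ = ∫ σ in a..τ, G τ σ := fun τ hτ => by
    simpa [F, indicator_apply] using
      intervalIntegral.integral_indicator (f := G τ) (μ := volume) (Ioc_subset_Icc_self hτ)
  have inner_right : ∀ σ ∈ Ioc a b, ∫ τ in a..b, F τ σ = ∫ τ in σ..b, G τ σ := fun σ hσ => by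
    have hFσ : (fun τ => F τ σ) = (Ici σ).indicator fun τ => G τ σ := by
      ext τ
      simp [F, indicator_apply]
    have hIoc : Ioc a b ∩ Ici σ = Icc σ b := by
      ext τ
      exact ⟨fun h => ⟨h.2, h.1.2⟩, fun h => ⟨⟨hσ.1.trans_le h.1, h.2⟩, h.1⟩⟩
    rw [hFσ, intervalIntegral.integral_of_le hab, setIntegral_indicator measurableSet_Ici, hIoc,
      integral_Icc_eq_integral_Ioc, ← intervalIntegral.integral_of_le hσ.2]
  calc ∫ τ in a..b, ∫ σ in a..τ, G τ σ
      = ∫ τ in a..b, ∫ σ in a..b, F τ σ := by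
        rw [intervalIntegral.integral_of_le hab, intervalIntegral.integral_of_le hab]
        exact setIntegral_congr_fun measurableSet_Ioc fun τ hτ => (inner_left τ hτ).symm
    _ = ∫ σ in a..b, ∫ τ in a..b, F τ σ := intervalIntegral_intervalIntegral_swap hF
    _ = ∫ σ in a..b, ∫ τ in σ..b, G τ σ := by
        rw [intervalIntegral.integral_of_le hab, intervalIntegral.integral_of_le hab]
        exact setIntegral_congr_fun measurableSet_Ioc inner_right

section Convolution

variable {𝕜 : Type*} [RCLike 𝕜] {f f' g g' h : ℝ → 𝕜} {t : ℝ}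

/-- The convolution of two causal signals, of which only the values on `[0, ∞)` matter; it is
the time-domain counterpart of the product of Laplace transforms. -/
def conv (f g : ℝ → 𝕜) (t : ℝ) : 𝕜 :=
  ∫ τ in (0 : ℝ)..t, f (t - τ) * g τ

lemma conv_congr (hf : EqOn f f' (Ici 0)) (hg : EqOn g g' (Ici 0)) (ht : 0 ≤ t) :
    conv f g t = conv f' g' t := by
  refine intervalIntegral.integral_congr fun τ hτ => ?_
  rw [uIcc_of_le ht] at hτ
  rw [hf (sub_nonneg.2 hτ.2), hg hτ.1]

lemma continuous_conv (hf : Continuous f) (hg : Continuous g) : Continuous (conv f g) :=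
  intervalIntegral.continuous_parametric_intervalIntegral_of_continuous
    (f := fun t τ => f (t - τ) * g τ) (by fun_prop) continuous_id

lemma continuousOn_conv (hf : ContinuousOn f (Ici 0)) (hg : ContinuousOn g (Ici 0)) :
    ContinuousOn (conv f g) (Ici 0) := by
  obtain ⟨f', hf', hff'⟩ := exists_continuous_eqOn_Ici hf
  obtain ⟨g', hg', hgg'⟩ := exists_continuous_eqOn_Ici hg
  exact (continuous_conv hf' hg').continuousOn.congr fun t ht => conv_congr hff' hgg' ht

lemma intervalIntegrable_sub_mul (hf : ContinuousOn f (Ici 0)) (hg : ContinuousOn g (Ici 0))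
    (ht : 0 ≤ t) : IntervalIntegrable (fun τ => f (t - τ) * g τ) volume 0 t := by
  refine ContinuousOn.intervalIntegrable_of_Icc ht (ContinuousOn.mul ?_ ?_)
  · exact hf.comp (by fun_prop) fun τ hτ => sub_nonneg.2 hτ.2
  · exact hg.mono fun τ hτ => hτ.1

lemma conv_add (hf : ContinuousOn f (Ici 0)) (hg : ContinuousOn g (Ici 0))
    (hh : ContinuousOn h (Ici 0)) (ht : 0 ≤ t) :
    conv f (g + h) t = conv f g t + conv f h t := by
  simp only [conv, Pi.add_apply, mul_add]
  exact intervalIntegral.integral_add (intervalIntegrable_sub_mul hf hg ht)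
    (intervalIntegrable_sub_mul hf hh ht)

lemma conv_sub (hf : ContinuousOn f (Ici 0)) (hg : ContinuousOn g (Ici 0))
    (hh : ContinuousOn h (Ici 0)) (ht : 0 ≤ t) :
    conv f (g - h) t = conv f g t - conv f h t := by
  simp only [conv, Pi.sub_apply, mul_sub]
  exact intervalIntegral.integral_sub (intervalIntegrable_sub_mul hf hg ht)
    (intervalIntegrable_sub_mul hf hh ht)

lemma sub_conv (hf : ContinuousOn f (Ici 0)) (hg : ContinuousOn g (Ici 0))
    (hh : ContinuousOn h (Ici 0)) (ht : 0 ≤ t) :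
    conv (f - g) h t = conv f h t - conv g h t := by
  simp only [conv, Pi.sub_apply, sub_mul]
  exact intervalIntegral.integral_sub (intervalIntegrable_sub_mul hf hh ht)
    (intervalIntegrable_sub_mul hg hh ht)

lemma conv_conv_of_continuous (hf : Continuous f) (hg : Continuous g) (hh : Continuous h)
    (ht : 0 ≤ t) : conv f (conv g h) t = conv (conv f g) h t := by
  let G : ℝ → ℝ → 𝕜 := fun τ σ => f (t - τ) * (g (τ - σ) * h σ)
  have hG : Continuous (Function.uncurry G) := by fun_prop
  have shift : ∀ σ, ∫ τ in σ..t, G τ σ = conv f g (t - σ) * h σ := fun σ => by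
    have hsub := intervalIntegral.integral_comp_sub_right (a := σ) (b := t)
      (fun ρ => f (t - σ - ρ) * g ρ * h σ) σ
    rw [sub_self] at hsub
    rw [conv, ← intervalIntegral.integral_mul_const, ← hsub]
    refine intervalIntegral.integral_congr fun τ _ => ?_
    simp only [G, sub_sub_sub_cancel_right, mul_assoc]
  calc conv f (conv g h) t
      = ∫ τ in (0 : ℝ)..t, ∫ σ in (0 : ℝ)..τ, G τ σ := by
        simp only [conv, G, ← intervalIntegral.integral_const_mul]
    _ = ∫ σ in (0 : ℝ)..t, ∫ τ in σ..t, G τ σ :=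
        intervalIntegral_swap_triangle ht <|
          (hG.continuousOn.integrableOn_compact (isCompact_Icc.prod isCompact_Icc)).mono_set
            (prod_mono Ioc_subset_Icc_self Ioc_subset_Icc_self)
    _ = conv (conv f g) h t := by simp only [shift]; rfl

lemma conv_conv (hf : ContinuousOn f (Ici 0)) (hg : ContinuousOn g (Ici 0))
    (hh : ContinuousOn h (Ici 0)) (ht : 0 ≤ t) :
    conv f (conv g h) t = conv (conv f g) h t := by
  obtain ⟨f', hf', hff'⟩ := exists_continuous_eqOn_Ici hf
  obtain ⟨g', hg', hgg'⟩ := exists_continuous_eqOn_Ici hg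
  obtain ⟨h', hh', hhh'⟩ := exists_continuous_eqOn_Ici hh
  rw [conv_congr hff' (fun s hs => conv_congr hgg' hhh' hs) ht,
    conv_congr (fun s hs => conv_congr hff' hgg' hs) hhh' ht,
    conv_conv_of_continuous hf' hg' hh' ht]

lemma norm_conv_le (hfc : ContinuousOn f (Ici 0)) (hf : IntegrableOn f (Ioi 0)) {B : ℝ}
    (ht : 0 ≤ t) (hB : ∀ τ ∈ Icc 0 t, ‖g τ‖ ≤ B) :
    ‖conv f g t‖ ≤ (∫ τ in Ioi (0 : ℝ), ‖f τ‖) * B := by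
  have hB_nonneg : 0 ≤ B := (norm_nonneg _).trans (hB 0 ⟨le_rfl, ht⟩)
  have hint : IntervalIntegrable (fun τ => ‖f (t - τ)‖ * B) volume 0 t :=
    ContinuousOn.intervalIntegrable_of_Icc ht <|
      (hfc.comp (by fun_prop) fun τ hτ => sub_nonneg.2 hτ.2).norm.mul continuousOn_const
  calc ‖conv f g t‖
      ≤ ∫ τ in (0 : ℝ)..t, ‖f (t - τ)‖ * B := by
        refine intervalIntegral.norm_integral_le_of_norm_le ht (.of_forall fun τ hτ => ?_) hint
        rw [norm_mul]
        exact mul_le_mul_of_nonneg_left (hB τ (Ioc_subset_Icc_self hτ)) (norm_nonneg _)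
    _ = (∫ τ in Ioc 0 t, ‖f τ‖) * B := by
        rw [intervalIntegral.integral_mul_const,
          intervalIntegral.integral_comp_sub_left (fun τ => ‖f τ‖) t, sub_self, sub_zero,
          intervalIntegral.integral_of_le ht]
    _ ≤ (∫ τ in Ioi (0 : ℝ), ‖f τ‖) * B := by
        refine mul_le_mul_of_nonneg_right ?_ hB_nonneg
        exact setIntegral_mono_set hf.norm (.of_forall fun _ => norm_nonneg _)
          Ioc_subset_Ioi_self.eventuallyLE

lemma integrableOn_conv (hf : IntegrableOn f (Ioi 0)) (hg : IntegrableOn g (Ioi 0)) :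
    IntegrableOn (conv f g) (Ioi 0) := by
  have hint := integrable_posConvolution (μ := volume) (ν := volume) hg hf
    (ContinuousLinearMap.mul ℝ 𝕜)
  rw [posConvolution, integrable_indicator_iff measurableSet_Ioi] at hint
  refine hint.congr (.of_forall fun t => ?_)
  simp [conv, mul_comm]

end Convolution

lemma ofReal_conv (f g : ℝ → ℝ) (t : ℝ) :
    ((conv f g t : ℝ) : ℂ) = conv (fun τ => (f τ : ℂ)) (fun τ => (g τ : ℂ)) t := by
  simp [conv, ← intervalIntegral.integral_ofReal]

/-! ### The Laplace transform -/

/-- The Laplace transform of a causal signal. -/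
def laplace (h : ℝ → ℂ) (s : ℂ) : ℂ :=
  ∫ t in Ioi (0 : ℝ), Complex.exp (-(s * t)) * h t

lemma laplace_conv {f g : ℝ → ℂ} {s : ℂ}
    (hf : IntegrableOn (fun t : ℝ => Complex.exp (-(s * t)) * f t) (Ioi 0))
    (hg : IntegrableOn (fun t : ℝ => Complex.exp (-(s * t)) * g t) (Ioi 0)) :
    laplace (conv f g) s = laplace f s * laplace g s := by
  have hmul := integral_posConvolution (μ := volume) (ν := volume) hg hf
    (ContinuousLinearMap.mul ℝ ℂ)
  simp only [ContinuousLinearMap.mul_apply'] at hmul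
  rw [laplace, laplace, laplace, mul_comm (∫ t in Ioi (0 : ℝ), Complex.exp (-(s * t)) * f t),
    ← hmul]
  refine setIntegral_congr_fun measurableSet_Ioi fun t _ => ?_
  simp only [conv, ← intervalIntegral.integral_const_mul]
  refine intervalIntegral.integral_congr fun τ _ => ?_
  have hexp : Complex.exp (-(s * t))
      = Complex.exp (-(s * τ)) * Complex.exp (-(s * (t - τ : ℝ))) := by
    rw [← Complex.exp_add]
    push_cast
    ring_nf
  simp only [hexp]
  ring

lemma integrableOn_exp_neg_mul {h : ℝ → ℂ} (hh : IntegrableOn h (Ioi 0)) {s : ℂ}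
    (hs : 0 ≤ s.re) : IntegrableOn (fun t : ℝ => Complex.exp (-(s * t)) * h t) (Ioi 0) := by
  refine Integrable.bdd_mul (c := 1) hh (by fun_prop) ?_
  refine (ae_restrict_iff' measurableSet_Ioi).2 (.of_forall fun t ht => ?_)
  simpa [Complex.norm_exp] using mul_nonneg hs (le_of_lt ht)

lemma fourier_indicator_exp_neg_mul (h : ℝ → ℂ) (σ w : ℝ) :
    FourierTransform.fourier
        ((Ioi 0).indicator fun t : ℝ => Complex.exp (-((σ : ℂ) * t)) * h t) w
      = laplace h (σ + (2 * Real.pi * w : ℝ) * Complex.I) := by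
  rw [Real.fourier_real_eq_integral_exp_smul, laplace, ← integral_indicator measurableSet_Ioi]
  congr 1
  funext t
  by_cases ht : t ∈ Ioi (0 : ℝ)
  · rw [indicator_of_mem ht, indicator_of_mem ht, smul_eq_mul, ← mul_assoc, ← Complex.exp_add]
    push_cast
    ring_nf
  · rw [indicator_of_notMem ht, indicator_of_notMem ht, smul_zero]

lemma eq_zero_of_fourier_eq_zero {V E : Type*} [NormedAddCommGroup V] [InnerProductSpace ℝ V]
    [MeasurableSpace V] [BorelSpace V] [FiniteDimensional ℝ V] [NormedAddCommGroup E]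
    [NormedSpace ℂ E] [CompleteSpace E] {f : V → E} {v : V} (hf : Integrable f)
    (hfourier : FourierTransform.fourier f = 0) (hv : ContinuousAt f v) : f v = 0 := by
  have hinv := hf.fourierInv_fourier_eq (by rw [hfourier]; exact integrable_zero _ _ _) hv
  simpa [hfourier, Real.fourierInv_eq] using hinv.symm

lemma eqOn_zero_of_laplace_eq_zero {h : ℝ → ℂ} (hc : ContinuousOn h (Ici 0)) {σ : ℝ}
    (hi : IntegrableOn (fun t : ℝ => Complex.exp (-((σ : ℂ) * t)) * h t) (Ioi 0))
    (hl : ∀ w : ℝ, laplace h (σ + w * Complex.I) = 0) : EqOn h 0 (Ici 0) := by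
  have hzero : EqOn h 0 (Ioi 0) := fun t ht => by
    have hcont : ContinuousAt
        ((Ioi 0).indicator fun t : ℝ => Complex.exp (-((σ : ℂ) * t)) * h t) t := by
      have hprod : ContinuousAt (fun t : ℝ => Complex.exp (-((σ : ℂ) * t)) * h t) t :=
        ContinuousAt.mul (by fun_prop) (hc.continuousAt (Ici_mem_nhds ht))
      refine hprod.congr ?_
      filter_upwards [Ioi_mem_nhds ht] with u hu
      rw [indicator_of_mem hu]
    have hweighted := eq_zero_of_fourier_eq_zero ((integrable_indicator_iff measurableSet_Ioi).2 hi)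
      (by ext w; rw [fourier_indicator_exp_neg_mul, hl, Pi.zero_apply]) hcont
    rw [indicator_of_mem ht] at hweighted
    exact (mul_eq_zero.1 hweighted).resolve_left (Complex.exp_ne_zero _)
  exact hzero.of_subset_closure hc continuousOn_const Ioi_subset_Ici_self (closure_Ioi _).ge

/-- The causal signal `h` is continuous and absolutely integrable, and its Laplace transform is
`F` on the open right half plane. -/
structure HasLaplace (h : ℝ → ℂ) (F : ℂ → ℂ) : Prop where
  continuousOn : ContinuousOn h (Ici 0)
  integrableOn : IntegrableOn h (Ioi 0)
  laplace_eq : ∀ s : ℂ, 0 < s.re → laplace h s = F s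

namespace HasLaplace

variable {f g : ℝ → ℂ} {F G : ℂ → ℂ}

lemma integrableOn_exp_neg_mul (hf : HasLaplace f F) {s : ℂ} (hs : 0 < s.re) :
    IntegrableOn (fun t : ℝ => Complex.exp (-(s * t)) * f t) (Ioi 0) :=
  L1Adaptive.integrableOn_exp_neg_mul hf.integrableOn hs.le

lemma congr (hf : HasLaplace f F) (hfg : EqOn f g (Ici 0))
    (hFG : ∀ s : ℂ, 0 < s.re → F s = G s) : HasLaplace g G where
  continuousOn := hf.continuousOn.congr hfg.symm
  integrableOn := hf.integrableOn.congr_fun (hfg.mono Ioi_subset_Ici_self) measurableSet_Ioi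
  laplace_eq s hs := by
    rw [← hFG s hs, ← hf.laplace_eq s hs]
    refine setIntegral_congr_fun measurableSet_Ioi fun t ht => ?_
    simp only [hfg (Ioi_subset_Ici_self ht)]

lemma add (hf : HasLaplace f F) (hg : HasLaplace g G) : HasLaplace (f + g) (F + G) where
  continuousOn := hf.continuousOn.add hg.continuousOn
  integrableOn := hf.integrableOn.add hg.integrableOn
  laplace_eq s hs := by
    simp only [laplace, Pi.add_apply, mul_add, ← hf.laplace_eq s hs, ← hg.laplace_eq s hs]
    exact integral_add (hf.integrableOn_exp_neg_mul hs) (hg.integrableOn_exp_neg_mul hs)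

lemma const_mul (hf : HasLaplace f F) (c : ℂ) :
    HasLaplace (fun t => c * f t) (fun s => c * F s) where
  continuousOn := continuousOn_const.mul hf.continuousOn
  integrableOn := hf.integrableOn.const_mul c
  laplace_eq s hs := by
    rw [← hf.laplace_eq s hs, laplace, laplace, ← integral_const_mul]
    simp only [mul_left_comm c]

lemma sub (hf : HasLaplace f F) (hg : HasLaplace g G) : HasLaplace (f - g) (F - G) :=
  (hf.add (hg.const_mul (-1))).congr (fun t _ => by simp [sub_eq_add_neg])
    fun s _ => by simp [sub_eq_add_neg]

lemma conv (hf : HasLaplace f F) (hg : HasLaplace g G) : HasLaplace (conv f g) (F * G) where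
  continuousOn := continuousOn_conv hf.continuousOn hg.continuousOn
  integrableOn := integrableOn_conv hf.integrableOn hg.integrableOn
  laplace_eq s hs := by
    rw [laplace_conv (hf.integrableOn_exp_neg_mul hs) (hg.integrableOn_exp_neg_mul hs),
      hf.laplace_eq s hs, hg.laplace_eq s hs, Pi.mul_apply]

lemma conj (hf : HasLaplace f F) :
    HasLaplace (fun t => (starRingEnd ℂ) (f t))
      (fun s => (starRingEnd ℂ) (F ((starRingEnd ℂ) s))) where
  continuousOn := Complex.continuous_conj.comp_continuousOn hf.continuousOn
  integrableOn := Complex.conjCLE.toContinuousLinearMap.integrable_comp hf.integrableOn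
  laplace_eq s hs := by
    rw [← hf.laplace_eq _ (by simpa using hs), laplace, laplace, ← integral_conj]
    simp [← Complex.exp_conj]

lemma ofReal_re (hf : HasLaplace f F) :
    HasLaplace (fun t => ((f t).re : ℂ))
      (fun s => (F s + (starRingEnd ℂ) (F ((starRingEnd ℂ) s))) / 2) :=
  ((hf.add hf.conj).const_mul (1 / 2)).congr
    (fun t _ => by simp [Complex.re_eq_add_conj, div_eq_inv_mul])
    fun s _ => by simp [div_eq_inv_mul]

lemma exp {a : ℂ} (ha : a.re < 0) :
    HasLaplace (fun t : ℝ => Complex.exp (a * t)) (fun s => 1 / (s - a)) where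
  continuousOn := by fun_prop
  integrableOn := integrableOn_exp_mul_complex_Ioi ha 0
  laplace_eq s hs := by
    have hre : (a - s).re < 0 := by rw [Complex.sub_re]; linarith
    have hexp : ∀ t : ℝ, -(s * t) + a * t = (a - s) * t := fun t => by ring
    simp only [laplace, ← Complex.exp_add, hexp, integral_exp_mul_complex_Ioi hre 0,
      Complex.ofReal_zero, mul_zero, Complex.exp_zero]
    rw [← neg_sub s a, neg_div_neg_eq]

end HasLaplace

lemma exists_hasLaplace_div_prod (s : Multiset ℂ) (hs : ∀ a ∈ s, a.re < 0) (p : Polynomial ℂ)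
    (hp : p.degree < (Multiset.card s : ℕ)) :
    ∃ h : ℝ → ℂ, HasLaplace h fun z => p.eval z / (s.map fun a => z - a).prod := by
  induction s using Multiset.induction_on generalizing p with
  | empty =>
    have hp_zero : p = 0 := Polynomial.degree_eq_bot.1 (Nat.WithBot.lt_zero_iff.1 hp)
    refine ⟨0, continuousOn_const, integrableOn_zero, fun z _ => ?_⟩
    simp [laplace, hp_zero]
  | cons a s ih =>
    -- With `q` the product over `s` and `p = r + q * c`, split `p / ((z - a) * q)` into
    -- `c / (z - a) + (1 / (z - a)) * (r / q)`.
    let q : Polynomial ℂ := (s.map fun a => Polynomial.X - Polynomial.C a).prod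
    have hq : q.Monic := Polynomial.monic_multisetProd_X_sub_C s
    have hq_degree : q.degree = (Multiset.card s : ℕ) := by
      rw [Polynomial.degree_eq_natDegree hq.ne_zero,
        Polynomial.natDegree_multiset_prod_X_sub_C_eq_card]
    have hq_eval : ∀ z, q.eval z = (s.map fun a => z - a).prod := fun z => by
      simp [q, Polynomial.eval_multiset_prod, Multiset.map_map]
    obtain ⟨c, hc⟩ : ∃ c, p /ₘ q = Polynomial.C c := by
      have hp_natDegree : p.natDegree ≤ Multiset.card s := by
        rw [Multiset.card_cons] at hp
        exact Polynomial.natDegree_le_iff_coeff_eq_zero.2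
          ((Polynomial.degree_lt_iff_coeff_zero _ _).1 hp)
      refine ⟨_, Polynomial.eq_C_of_natDegree_eq_zero ?_⟩
      rw [Polynomial.natDegree_divByMonic _ hq, Polynomial.natDegree_multiset_prod_X_sub_C_eq_card]
      exact Nat.sub_eq_zero_of_le hp_natDegree
    obtain ⟨h, hh⟩ := ih (fun b hb => hs b (Multiset.mem_cons_of_mem hb)) (p %ₘ q)
      (hq_degree ▸ Polynomial.degree_modByMonic_lt p hq)
    have hexp := HasLaplace.exp (hs a (Multiset.mem_cons_self a s))
    refine ⟨_, ((hexp.const_mul c).add (hexp.conv hh)).congr (fun _ _ => rfl) fun z hz => ?_⟩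
    have hprod : ((a ::ₘ s).map fun b => z - b).prod ≠ 0 := by
      refine Multiset.prod_ne_zero fun hzero => ?_
      obtain ⟨b, hb, hzb⟩ := Multiset.mem_map.1 hzero
      exact (hs b hb).not_gt (sub_eq_zero.1 hzb ▸ hz)
    rw [Multiset.map_cons, Multiset.prod_cons] at hprod ⊢
    have hp_eval : p.eval z = (p %ₘ q).eval z + (s.map fun b => z - b).prod * c := by
      conv_lhs => rw [← Polynomial.modByMonic_add_div p q, hc]
      simp [hq_eval]
    obtain ⟨hza, hsz⟩ := mul_ne_zero_iff.1 hprod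
    simp only [Pi.add_apply, Pi.mul_apply, hp_eval]
    field_simp
    ring

/-! ### Stable transfer functions -/

lemma IsImpulseResponse.eqOn {f g : ℝ → ℝ} {H : RatFunc ℝ} (hf : IsImpulseResponse f H)
    (hg : IsImpulseResponse g H) : EqOn f g (Ici 0) := by
  obtain ⟨hfc, σ, hf⟩ := hf
  obtain ⟨hgc, σ', hg⟩ := hg
  obtain ⟨ρ, hρ⟩ := exists_gt (max σ σ')
  have hf' := fun w : ℝ => hf (ρ + w * Complex.I) (by simpa using (le_max_left _ _).trans_lt hρ)
  have hg' := fun w : ℝ => hg (ρ + w * Complex.I) (by simpa using (le_max_right _ _).trans_lt hρ)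
  have hzero : EqOn (fun t => (f t : ℂ) - g t) 0 (Ici 0) := by
    refine eqOn_zero_of_laplace_eq_zero (σ := ρ)
      ((Complex.continuous_ofReal.comp_continuousOn hfc).sub
        (Complex.continuous_ofReal.comp_continuousOn hgc)) ?_ fun w => ?_
    · simpa [mul_sub] using! (hf' 0).1.sub (hg' 0).1
    · simp only [laplace, mul_sub]
      rw [integral_sub (hf' w).1 (hg' w).1, (hf' w).2, (hg' w).2, sub_self]
  exact fun t ht => Complex.ofReal_injective (sub_eq_zero.1 (hzero ht))

lemma eqOn_impulseResponse {h : ℝ → ℝ} {H : RatFunc ℝ} (hh : IsImpulseResponse h H) :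
    EqOn (impulseResponse H) h (Ici 0) := by
  have hex : ∃ f : ℝ → ℝ, IsImpulseResponse f H := ⟨h, hh⟩
  rw [impulseResponse, dif_pos hex]
  exact hex.choose_spec.eqOn hh

lemma isImpulseResponse_of_hasLaplace {h : ℝ → ℝ} {H : RatFunc ℝ}
    (hh : HasLaplace (fun t => (h t : ℂ)) (H.eval (algebraMap ℝ ℂ))) : IsImpulseResponse h H :=
  ⟨Complex.continuous_re.comp_continuousOn hh.continuousOn, 0,
    fun s hs => ⟨hh.integrableOn_exp_neg_mul hs, hh.laplace_eq s hs⟩⟩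

/-- The transfer function `H` has no poles in the open right half plane, where it is the Laplace
transform of its impulse response, and the latter is continuous and absolutely integrable. This
form of stability is preserved by products and differences, without degree bookkeeping. -/
structure HasStableResponse (H : RatFunc ℝ) : Prop where
  denom_ne_zero : ∀ s : ℂ, 0 < s.re → H.denom.eval₂ (algebraMap ℝ ℂ) s ≠ 0
  hasLaplace : HasLaplace (fun t => (impulseResponse H t : ℂ)) (H.eval (algebraMap ℝ ℂ))

lemma hasStableResponse_of_hasLaplace {h : ℝ → ℝ} {H : RatFunc ℝ}
    (hH : ∀ s : ℂ, 0 < s.re → H.denom.eval₂ (algebraMap ℝ ℂ) s ≠ 0)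
    (hh : HasLaplace (fun t => (h t : ℂ)) (H.eval (algebraMap ℝ ℂ))) : HasStableResponse H where
  denom_ne_zero := hH
  hasLaplace := hh.congr (fun t ht => by
    rw [eqOn_impulseResponse (isImpulseResponse_of_hasLaplace hh) ht]) fun _ _ => rfl

lemma eval₂_denom_ne_zero_of_dvd {H : RatFunc ℝ} {p : Polynomial ℝ} (hp : H.denom ∣ p) {s : ℂ}
    (hs : p.eval₂ (algebraMap ℝ ℂ) s ≠ 0) : H.denom.eval₂ (algebraMap ℝ ℂ) s ≠ 0 :=
  fun hzero => hs (Polynomial.eval₂_eq_zero_of_dvd_of_eval₂_eq_zero _ _ hp hzero)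

lemma denom_sub_dvd {R : Type*} [Field R] (F G : RatFunc R) :
    (F - G).denom ∣ F.denom * G.denom := by
  rw [RatFunc.denom_dvd (mul_ne_zero F.denom_ne_zero G.denom_ne_zero)]
  refine ⟨F.num * G.denom - F.denom * G.num, ?_⟩
  rw [map_mul, map_sub, map_mul, map_mul, ← div_sub_div, RatFunc.num_div_denom,
    RatFunc.num_div_denom]
  · exact RatFunc.algebraMap_ne_zero F.denom_ne_zero
  · exact RatFunc.algebraMap_ne_zero G.denom_ne_zero

namespace HasStableResponse

variable {F G H : RatFunc ℝ} {v w : ℝ → ℝ} {t : ℝ}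

lemma continuousOn (hH : HasStableResponse H) : ContinuousOn (impulseResponse H) (Ici 0) :=
  Complex.continuous_re.comp_continuousOn hH.hasLaplace.continuousOn

lemma integrableOn (hH : HasStableResponse H) : IntegrableOn (impulseResponse H) (Ioi 0) :=
  hH.hasLaplace.integrableOn.re

lemma hasLaplace_conv (hF : HasStableResponse F) (hG : HasStableResponse G) :
    HasLaplace (fun t => ((conv (impulseResponse F) (impulseResponse G) t : ℝ) : ℂ))
      ((F * G).eval (algebraMap ℝ ℂ)) :=
  (hF.hasLaplace.conv hG.hasLaplace).congr (fun t _ => (ofReal_conv _ _ t).symm) fun s hs => by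
    rw [Pi.mul_apply, RatFunc.eval_mul _ _ (hF.denom_ne_zero s hs) (hG.denom_ne_zero s hs)]

lemma mul (hF : HasStableResponse F) (hG : HasStableResponse G) : HasStableResponse (F * G) :=
  hasStableResponse_of_hasLaplace (fun s hs =>
    eval₂_denom_ne_zero_of_dvd (RatFunc.denom_mul_dvd F G) <| by
      rw [Polynomial.eval₂_mul]
      exact mul_ne_zero (hF.denom_ne_zero s hs) (hG.denom_ne_zero s hs)) (hF.hasLaplace_conv hG)

lemma response_mul (hF : HasStableResponse F) (hG : HasStableResponse G)
    (hv : ContinuousOn v (Ici 0)) (ht : 0 ≤ t) :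
    response (F * G) v t = response F (response G v) t :=
  (conv_congr (eqOn_impulseResponse (isImpulseResponse_of_hasLaplace (hF.hasLaplace_conv hG)))
    (fun _ _ => rfl) ht).trans (conv_conv hF.continuousOn hG.continuousOn hv ht).symm

lemma eval₂_denom_sub_ne_zero (hF : HasStableResponse F) (hG : HasStableResponse G) {s : ℂ}
    (hs : 0 < s.re) : (F - G).denom.eval₂ (algebraMap ℝ ℂ) s ≠ 0 :=
  eval₂_denom_ne_zero_of_dvd (denom_sub_dvd F G) <| by
    rw [Polynomial.eval₂_mul]
    exact mul_ne_zero (hF.denom_ne_zero s hs) (hG.denom_ne_zero s hs)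

lemma hasLaplace_sub (hF : HasStableResponse F) (hG : HasStableResponse G) :
    HasLaplace (fun t => ((impulseResponse F - impulseResponse G) t : ℂ))
      ((F - G).eval (algebraMap ℝ ℂ)) :=
  (hF.hasLaplace.sub hG.hasLaplace).congr (fun t _ => by simp) fun s hs => by
    rw [Pi.sub_apply, sub_eq_iff_eq_add,
      ← RatFunc.eval_add _ _ (hF.eval₂_denom_sub_ne_zero hG hs) (hG.denom_ne_zero s hs),
      sub_add_cancel]

lemma sub (hF : HasStableResponse F) (hG : HasStableResponse G) : HasStableResponse (F - G) :=
  hasStableResponse_of_hasLaplace (fun _ => hF.eval₂_denom_sub_ne_zero hG) (hF.hasLaplace_sub hG)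

lemma response_sub (hF : HasStableResponse F) (hG : HasStableResponse G)
    (hv : ContinuousOn v (Ici 0)) (ht : 0 ≤ t) :
    response (F - G) v t = response F v t - response G v t :=
  (conv_congr (eqOn_impulseResponse (isImpulseResponse_of_hasLaplace (hF.hasLaplace_sub hG)))
    (fun _ _ => rfl) ht).trans (sub_conv hF.continuousOn hG.continuousOn hv ht)

lemma response_add_right (hH : HasStableResponse H) (hv : ContinuousOn v (Ici 0))
    (hw : ContinuousOn w (Ici 0)) (ht : 0 ≤ t) :
    response H (v + w) t = response H v t + response H w t :=
  conv_add hH.continuousOn hv hw ht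

lemma response_sub_right (hH : HasStableResponse H) (hv : ContinuousOn v (Ici 0))
    (hw : ContinuousOn w (Ici 0)) (ht : 0 ≤ t) :
    response H (v - w) t = response H v t - response H w t :=
  conv_sub hH.continuousOn hv hw ht

lemma continuousOn_response (hH : HasStableResponse H) (hv : ContinuousOn v (Ici 0)) :
    ContinuousOn (response H v) (Ici 0) :=
  continuousOn_conv hH.continuousOn hv

lemma abs_response_le (hH : HasStableResponse H) {B : ℝ} (ht : 0 ≤ t)
    (hB : ∀ τ ∈ Icc 0 t, |v τ| ≤ B) :
    |response H v t| ≤ (∫ τ in Ioi (0 : ℝ), |impulseResponse H τ|) * B :=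
  norm_conv_le hH.continuousOn hH.integrableOn ht hB

end HasStableResponse

lemma conj_eval_conj (H : RatFunc ℝ) (z : ℂ) :
    (starRingEnd ℂ) (H.eval (algebraMap ℝ ℂ) ((starRingEnd ℂ) z))
      = H.eval (algebraMap ℝ ℂ) z := by
  have hpoly : ∀ p : Polynomial ℝ,
      (starRingEnd ℂ) (p.eval₂ (algebraMap ℝ ℂ) ((starRingEnd ℂ) z))
        = p.eval₂ (algebraMap ℝ ℂ) z := fun p => by
    have hcomp : (starRingEnd ℂ).comp (algebraMap ℝ ℂ) = algebraMap ℝ ℂ := by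
      ext x
      simp
    rw [Polynomial.hom_eval₂, hcomp, Complex.conj_conj]
  simp [RatFunc.eval, hpoly]

lemma hasStableResponse_of_isStable {H : RatFunc ℝ} (hH : IsStable H)
    (hproper : IsStrictlyProper H) : HasStableResponse H := by
  let q : Polynomial ℂ := H.denom.map (algebraMap ℝ ℂ)
  let p : Polynomial ℂ := H.num.map (algebraMap ℝ ℂ)
  have hq : q.Monic := (RatFunc.monic_denom H).map _
  have hsplits : q.Splits := IsAlgClosed.splits q
  have hq_prod : ∀ z, (q.roots.map fun a => z - a).prod = q.eval z := fun z => by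
    conv_rhs => rw [hsplits.eq_prod_roots_of_monic hq]
    simp [Polynomial.eval_multiset_prod, Multiset.map_map]
  have hroots : ∀ a ∈ q.roots, a.re < 0 := fun a ha => hH a <| by
    rw [← Polynomial.eval_map]
    exact (Polynomial.mem_roots hq.ne_zero).1 ha
  have hdegree : p.degree < (Multiset.card q.roots : ℕ) := by
    rw [← hsplits.natDegree_eq_card_roots, ← Polynomial.degree_eq_natDegree hq.ne_zero,
      Polynomial.degree_map, Polynomial.degree_map]
    exact hproper
  obtain ⟨h, hh⟩ := exists_hasLaplace_div_prod q.roots hroots p hdegree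
  have hh' : HasLaplace h (H.eval (algebraMap ℝ ℂ)) := hh.congr (fun _ _ => rfl) fun z _ => by
    rw [hq_prod, RatFunc.eval, Polynomial.eval_map, Polynomial.eval_map]
  refine hasStableResponse_of_hasLaplace (h := fun t => (h t).re)
    (fun s hs hzero => (hH s hzero).not_gt hs) (hh'.ofReal_re.congr (fun _ _ => rfl) fun z _ => ?_)
  rw [conj_eval_conj, add_self_div_two]

/-! ### Linear differential equations -/

lemma variation_of_constants {E : Type*} [NormedAddCommGroup E] [NormedSpace ℝ E]
    [CompleteSpace E] {A : E →L[ℝ] E} {Φ : ℝ → E →L[ℝ] E}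
    (hΦ : ∀ t, HasDerivAt Φ (Φ t ∘L A) t) (hΦ0 : Φ 0 = .id ℝ E) {y w : ℝ → E}
    (hw : ContinuousOn w (Ici 0))
    (hy : ∀ t, 0 ≤ t → HasDerivWithinAt y (A (y t) + w t) (Ici 0) t) {t : ℝ} (ht : 0 ≤ t) :
    y t = Φ t (y 0) + ∫ τ in (0 : ℝ)..t, Φ (t - τ) (w τ) := by
  have hΦ' : ∀ τ : ℝ, HasDerivAt (fun τ => Φ (t - τ)) (-(Φ (t - τ) ∘L A)) τ := fun τ =>
    (hΦ (t - τ)).comp_const_sub t τ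
  have hderiv : ∀ τ : ℝ, 0 ≤ τ →
      HasDerivWithinAt (fun τ => Φ (t - τ) (y τ)) (Φ (t - τ) (w τ)) (Ici 0) τ := fun τ hτ => by
    convert! (hΦ' τ).hasDerivWithinAt.clm_apply (hy τ hτ) using 1
    simp
  have hcont : ContinuousOn (fun τ => Φ (t - τ) (w τ)) (Ici 0) :=
    ContinuousOn.clm_apply (fun τ _ => (hΦ' τ).continuousAt.continuousWithinAt) hw
  rw [intervalIntegral.integral_eq_sub_of_hasDerivAt_of_le ht
    (fun τ hτ => (hderiv τ hτ.1).continuousWithinAt.mono Icc_subset_Ici_self)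
    (fun τ hτ => (hderiv τ hτ.1.le).hasDerivAt (Ici_mem_nhds hτ.1))
    ((hcont.mono Icc_subset_Ici_self).intervalIntegrable_of_Icc ht)]
  simp [hΦ0]

section ComplexBanach

variable {F : Type*} [NormedAddCommGroup F] [NormedSpace ℂ F] [CompleteSpace F]

lemma integrableOn_of_hasDerivAt_smul_add {a : ℂ} (ha : a.re < 0) {y g : ℝ → F}
    (hy : ∀ t, HasDerivAt y (a • y t + g t) t) (hg : Continuous g)
    (hgi : IntegrableOn g (Ioi 0)) : IntegrableOn y (Ioi 0) := by
  have hexp : ∀ t : ℝ, HasDerivAt (fun t : ℝ => Complex.exp (a * t)) (Complex.exp (a * t) * a) t :=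
    fun t => by simpa using ((hasDerivAt_id t).ofReal_comp.const_mul a).cexp
  have hformula : ∀ t ∈ Ioi (0 : ℝ), Complex.exp (a * t) • y 0
      + ∫ τ in (0 : ℝ)..t, Complex.exp (a * (t - τ : ℝ)) • g τ = y t := fun t ht =>
    (variation_of_constants (A := a • .id ℝ F) (Φ := fun t => Complex.exp (a * t) • .id ℝ F)
      (fun t => by
        convert! (hexp t).smul_const (ContinuousLinearMap.id ℝ F) using 1
        ext
        simp [mul_smul])
      (by simp) hg.continuousOn (fun t _ => (hy t).hasDerivWithinAt) (mem_Ioi.1 ht).le).symm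
  have hexp_int : IntegrableOn (fun t : ℝ => Complex.exp (a * t)) (Ioi 0) :=
    integrableOn_exp_mul_complex_Ioi ha 0
  have hconv := (integrable_posConvolution (μ := volume) hgi hexp_int
    (ContinuousLinearMap.lsmul ℝ ℂ).flip).integrableOn (s := Ioi 0)
  refine IntegrableOn.congr_fun ((hexp_int.smul_const (y 0)).add hconv) (fun t ht => ?_)
    measurableSet_Ioi
  rw [← hformula t ht]
  simp [posConvolution, indicator_of_mem ht]

lemma integrableOn_of_aeval_prod_eq_zero {M : F →L[ℂ] F} (s : Multiset ℂ)
    (hs : ∀ a ∈ s, a.re < 0) {y : ℝ → F} (hy : ∀ t, HasDerivAt y (M (y t)) t)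
    (hzero : ∀ t, Polynomial.aeval M
      (s.map fun a => Polynomial.X - Polynomial.C a).prod (y t) = 0) :
    IntegrableOn y (Ioi 0) := by
  induction s using Multiset.induction_on generalizing y with
  | empty =>
    have hy0 : y = 0 := funext fun t => by simpa using hzero t
    exact hy0 ▸ integrableOn_zero
  | cons a s ih =>
    let z : ℝ → F := fun t => M (y t) - a • y t
    have hz : ∀ t, HasDerivAt z (M (z t)) t := fun t => by
      convert! ((M.restrictScalars ℝ).hasFDerivAt.comp_hasDerivAt t (hy t)).sub
        ((hy t).const_smul a) using 1
      simp [z]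
    have hz_int : IntegrableOn z (Ioi 0) :=
      ih (fun b hb => hs b (Multiset.mem_cons_of_mem hb)) hz fun t => by
        have hzero_t := hzero t
        rw [Multiset.map_cons, Multiset.prod_cons, mul_comm, map_mul] at hzero_t
        simpa [z, Algebra.algebraMap_eq_smul_one] using hzero_t
    exact integrableOn_of_hasDerivAt_smul_add (hs a (Multiset.mem_cons_self a s))
      (fun t => by simpa [z] using hy t)
      (continuous_iff_continuousAt.2 fun t => (hz t).continuousAt) hz_int

end ComplexBanach

section Flow

variable {ι : Type*} [Fintype ι]

/-- The solution `exp (t A) x` of `y' = A y`, `y(0) = x`. -/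
def flow (A : Matrix ι ι ℝ) (x : ι → ℝ) (t : ℝ) : ι → ℝ :=
  NormedSpace.exp (t • LinearMap.toContinuousLinearMap A.mulVecLin) x

variable (A : Matrix ι ι ℝ) (b x : ι → ℝ) (i : ι)

lemma flow_zero : flow A x 0 = x := by
  simp [flow]

lemma hasDerivAt_flow (t : ℝ) : HasDerivAt (flow A x) (A *ᵥ flow A x t) t :=
  ((hasDerivAt_exp_smul_const' (LinearMap.toContinuousLinearMap A.mulVecLin) t).clm_apply
    (hasDerivAt_const t x)).congr_deriv (by simp [flow])

lemma hasDerivAt_flow_apply (t : ℝ) :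
    HasDerivAt (fun t => flow A x t i) ((A *ᵥ flow A x t) i) t :=
  hasDerivAt_pi.1 (hasDerivAt_flow A x t) i

lemma continuous_flow_apply : Continuous fun t => flow A x t i :=
  continuous_iff_continuousAt.2 fun t => (hasDerivAt_flow_apply A x i t).continuousAt

variable {A b x}

lemma flow_ne_zero (hx : x ≠ 0) (t : ℝ) : flow A x t ≠ 0 := by
  let _ : NormedAlgebra ℚ ((ι → ℝ) →L[ℝ] ι → ℝ) := .restrictScalars ℚ ℝ _
  obtain ⟨Ψ, hΨ⟩ := (NormedSpace.isUnit_exp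
    (t • LinearMap.toContinuousLinearMap A.mulVecLin)).exists_left_inv
  intro hzero
  exact hx ((DFunLike.congr_fun hΨ x).symm.trans ((congrArg Ψ hzero).trans (map_zero Ψ)))

lemma eq_flow_add_conv {y : ℝ → ι → ℝ} {w : ℝ → ℝ} (hw : ContinuousOn w (Ici 0))
    (hy : ∀ t, 0 ≤ t → HasDerivWithinAt y (A *ᵥ y t + w t • b) (Ici 0) t) {t : ℝ} (ht : 0 ≤ t) :
    y t i = flow A (y 0) t i + conv (fun t => flow A b t i) w t := by
  let L : (ι → ℝ) →L[ℝ] ι → ℝ := LinearMap.toContinuousLinearMap A.mulVecLin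
  have hcont : ContinuousOn (fun τ => w τ • flow A b (t - τ)) (Icc 0 t) :=
    (hw.mono Icc_subset_Ici_self).smul (Continuous.continuousOn <| continuous_pi fun j =>
      (continuous_flow_apply A b j).comp (continuous_sub_left t))
  have hformula : y t = flow A (y 0) t + ∫ τ in (0 : ℝ)..t, w τ • flow A b (t - τ) := by
    simpa [flow, L] using variation_of_constants (A := L) (hasDerivAt_exp_smul_const L)
      (by simp; rfl) (hw.smul (continuousOn_const (c := b))) hy ht
  have happly :=
    (ContinuousLinearMap.proj (R := ℝ) (φ := fun _ : ι => ℝ) i).intervalIntegral_comp_comm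
      (hcont.intervalIntegrable_of_Icc (μ := volume) ht)
  simp only [ContinuousLinearMap.proj_apply, Pi.smul_apply, smul_eq_mul] at happly
  simp only [hformula, Pi.add_apply, conv, ← happly, mul_comm]

end Flow

/-! ### Hurwitz matrices -/

section Hurwitz

variable {n : ℕ} {A : Matrix (Fin n) (Fin n) ℝ} (b x : Fin n → ℝ) (i : Fin n)

lemma IsHurwitz.integrableOn_flow (hA : IsHurwitz A) :
    IntegrableOn (fun t => flow A x t i) (Ioi 0) := by
  let M : Matrix (Fin n) (Fin n) ℂ := A.map (algebraMap ℝ ℂ)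
  let Λ : Matrix (Fin n) (Fin n) ℂ ≃ₐ[ℂ] ((Fin n → ℂ) →L[ℂ] Fin n → ℂ) :=
    Matrix.toLinAlgEquiv'.trans (Module.End.toContinuousLinearMap _)
  have hderiv : ∀ t, HasDerivAt (fun t i => (flow A x t i : ℂ))
      (Λ M fun i => (flow A x t i : ℂ)) t := fun t => hasDerivAt_pi.2 fun i => by
    convert! (hasDerivAt_flow_apply A x i t).ofReal_comp using 1
    change (M *ᵥ _) i = _
    simp [M, Matrix.mulVec, dotProduct]
  have hroots : (M.charpoly.roots.map fun a => Polynomial.X - Polynomial.C a).prod = M.charpoly :=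
    ((IsAlgClosed.splits M.charpoly).eq_prod_roots_of_monic M.charpoly_monic).symm
  have hzero : Polynomial.aeval (Λ M) M.charpoly = 0 := by
    exact (Polynomial.aeval_algHom_apply Λ M _).trans (by rw [M.aeval_self_charpoly, map_zero])
  have hflow := integrableOn_of_aeval_prod_eq_zero M.charpoly.roots
    (fun a ha => hA a (Matrix.mem_spectrum_iff_isRoot_charpoly.2
      (Polynomial.isRoot_of_mem_roots ha)))
    hderiv fun t => by rw [hroots, hzero]; rfl
  exact ((ContinuousLinearMap.proj (R := ℝ) (φ := fun _ : Fin n => ℂ) i).integrable_comp hflow).re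

lemma IsHurwitz.tendsto_flow (hA : IsHurwitz A) :
    Tendsto (fun t => flow A x t i) atTop (𝓝 0) :=
  tendsto_zero_of_hasDerivAt_of_integrableOn_Ioi (a := 0)
    (fun t _ => hasDerivAt_flow_apply A x i t)
    (integrable_finsetSum Finset.univ fun j _ => (hA.integrableOn_flow x j).const_mul (A i j))
    (hA.integrableOn_flow x i)

end Hurwitz

lemma exists_norm_le_of_tendsto {E : Type*} [NormedAddCommGroup E] {f : ℝ → E} {l : E}
    (hf : ContinuousOn f (Ici 0)) (hlim : Tendsto f atTop (𝓝 l)) :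
    ∃ M, ∀ t, 0 ≤ t → ‖f t‖ ≤ M := by
  obtain ⟨T, hT⟩ := eventually_atTop.1 (hlim.norm.eventually (ge_mem_nhds (lt_add_one ‖l‖)))
  obtain ⟨B, hB⟩ := (isCompact_Icc (a := 0) (b := T)).exists_bound_of_continuousOn
    (hf.mono Icc_subset_Ici_self)
  refine ⟨max B (‖l‖ + 1), fun t ht => ?_⟩
  rcases le_total t T with htT | hTt
  · exact (hB t ⟨ht, htT⟩).trans (le_max_left _ _)
  · exact (hT t hTt).trans (le_max_right _ _)

lemma laplace_deriv {f f' : ℝ → ℂ} (hderiv : ∀ t, HasDerivAt f (f' t) t)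
    (hf : IntegrableOn f (Ioi 0)) (hf' : IntegrableOn f' (Ioi 0)) {s : ℂ} (hs : 0 ≤ s.re) :
    laplace f' s = s * laplace f s - f 0 := by
  have hexp_int := integrableOn_exp_neg_mul hf hs
  have hexp_int' := integrableOn_exp_neg_mul hf' hs
  have hprod : ∀ t : ℝ, HasDerivAt (fun t : ℝ => Complex.exp (-(s * t)) * f t)
      (Complex.exp (-(s * t)) * f' t - s * (Complex.exp (-(s * t)) * f t)) t := fun t => by
    have hexp : HasDerivAt (fun t : ℝ => Complex.exp (-(s * t)))
        (Complex.exp (-(s * t)) * -s) t := by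
      simpa using ((hasDerivAt_id t).ofReal_comp.const_mul s).neg.cexp
    convert! hexp.mul (hderiv t) using 1
    ring
  have hprod_int := hexp_int'.sub (hexp_int.const_mul s)
  have hFTC := integral_Ioi_of_hasDerivAt_of_tendsto' (a := 0) (fun t _ => hprod t) hprod_int
    (tendsto_zero_of_hasDerivAt_of_integrableOn_Ioi (a := 0) (fun t _ => hprod t) hprod_int
      hexp_int)
  rw [integral_sub hexp_int' (hexp_int.const_mul s), integral_const_mul] at hFTC
  simp only [Complex.ofReal_zero, mul_zero, neg_zero, Complex.exp_zero, one_mul] at hFTC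
  rw [laplace, laplace]
  linear_combination hFTC

lemma mapMatrix_charmatrix {ι R S : Type*} [Fintype ι] [DecidableEq ι] [CommRing R] [CommRing S]
    (φ : Polynomial R →+* S) (A : Matrix ι ι R) :
    φ.mapMatrix A.charmatrix
      = Matrix.scalar ι (φ Polynomial.X) - A.map (φ.comp Polynomial.C) := by
  ext i j
  by_cases hij : i = j
  · simp [hij]
  · simp [hij]

lemma eval_div_algebraMap {R L : Type _} [Field R] [Field L] (f : R →+* L)
    {p q : Polynomial R} {s : L} (hq : q.eval₂ f s ≠ 0) :
    (algebraMap _ (RatFunc R) p / algebraMap _ (RatFunc R) q).eval f s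
      = p.eval₂ f s / q.eval₂ f s := by
  have hq0 : q ≠ 0 := by
    rintro rfl
    simp at hq
  have hden := mt (Polynomial.eval₂_eq_zero_of_dvd_of_eval₂_eq_zero f s
    (RatFunc.denom_div_dvd p q)) hq
  have hden' : (algebraMap _ (RatFunc R) q).denom.eval₂ f s ≠ 0 := by
    simp [RatFunc.denom_algebraMap]
  have hmul := RatFunc.eval_mul f s hden hden'
  rw [div_mul_cancel₀ _ (RatFunc.algebraMap_ne_zero hq0), RatFunc.eval_algebraMap,
    RatFunc.eval_algebraMap] at hmul
  exact (eq_div_iff hq).2 hmul.symm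

section TransferFunction

variable {n : ℕ} {A : Matrix (Fin n) (Fin n) ℝ} (b : Fin n → ℝ) (i : Fin n)

/-- The numerator of `(s I - A)⁻¹ b` over the characteristic polynomial of `A`. -/
def hoNum (A : Matrix (Fin n) (Fin n) ℝ) (b : Fin n → ℝ) : Fin n → Polynomial ℝ :=
  A.charmatrix.adjugate *ᵥ fun j => Polynomial.C (b j)

lemma Ho_eq_div : Ho A b i
    = algebraMap _ (RatFunc ℝ) (hoNum A b i) / algebraMap _ (RatFunc ℝ) A.charpoly := by
  let φ : Polynomial ℝ →+* RatFunc ℝ := algebraMap _ _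
  have hC : φ.comp Polynomial.C = RatFunc.C := RingHom.ext RatFunc.algebraMap_C
  have hmatrix : Matrix.scalar (Fin n) RatFunc.X - A.map RatFunc.C = φ.mapMatrix A.charmatrix := by
    rw [mapMatrix_charmatrix, hC, ← RatFunc.algebraMap_X]
  have hnum : φ.mapMatrix A.charmatrix.adjugate *ᵥ (fun j => RatFunc.C (b j))
      = fun i => φ (hoNum A b i) := by
    ext i
    rw [hoNum, RingHom.map_mulVec, ← hC]
    rfl
  rw [Ho, hmatrix, Matrix.inv_def, ← RingHom.map_det, ← RingHom.map_adjugate,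
    Ring.inverse_eq_inv', Matrix.smul_mulVec, hnum, Pi.smul_apply, smul_eq_mul, mul_comm,
    ← div_eq_mul_inv]
  rfl

variable {b i}

lemma IsHurwitz.eval₂_charpoly_ne_zero (hA : IsHurwitz A) {s : ℂ} (hs : 0 < s.re) :
    A.charpoly.eval₂ (algebraMap ℝ ℂ) s ≠ 0 := fun hzero => by
  rw [← Polynomial.eval_map, ← Matrix.charpoly_map] at hzero
  exact (hA s (Matrix.mem_spectrum_iff_isRoot_charpoly.2 hzero)).not_gt hs

lemma IsHurwitz.mulVec_laplace_flow (hA : IsHurwitz A) {s : ℂ} (hs : 0 < s.re) :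
    (Matrix.scalar (Fin n) s - A.map (algebraMap ℝ ℂ)) *ᵥ
      (fun i => laplace (fun t => (flow A b t i : ℂ)) s) = fun i => (b i : ℂ) := by
  have hint : ∀ j, IntegrableOn (fun t => (flow A b t j : ℂ)) (Ioi 0) := fun j =>
    (hA.integrableOn_flow b j).ofReal
  funext i
  have hderiv := laplace_deriv (f := fun t => (flow A b t i : ℂ))
    (f' := fun t => ∑ j, (A i j : ℂ) * flow A b t j)
    (fun t => by
      simpa [Matrix.mulVec, dotProduct] using (hasDerivAt_flow_apply A b i t).ofReal_comp)
    (hint i) (integrable_finsetSum _ fun j _ => (hint j).const_mul _) hs.le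
  have hsum : laplace (fun t => ∑ j, (A i j : ℂ) * flow A b t j) s
      = ∑ j, (A i j : ℂ) * laplace (fun t => (flow A b t j : ℂ)) s := by
    simp only [laplace, Finset.mul_sum, mul_left_comm _ (A i _ : ℂ)]
    rw [integral_finsetSum _ fun j _ => (integrableOn_exp_neg_mul (hint j) hs.le).const_mul _]
    simp only [integral_const_mul]
  rw [hsum, flow_zero] at hderiv
  simp only [Matrix.sub_mulVec, Pi.sub_apply, Matrix.scalar_apply, Matrix.mulVec_diagonal]
  simp only [Matrix.mulVec, dotProduct, Matrix.map_apply, Complex.coe_algebraMap]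
  linear_combination -hderiv

lemma IsHurwitz.laplace_flow (hA : IsHurwitz A) {s : ℂ} (hs : 0 < s.re) :
    laplace (fun t => (flow A b t i : ℂ)) s = (Ho A b i).eval (algebraMap ℝ ℂ) s := by
  let ψ : Polynomial ℝ →+* ℂ := Polynomial.eval₂RingHom (algebraMap ℝ ℂ) s
  let ℓ : Fin n → ℂ := fun i => laplace (fun t => (flow A b t i : ℂ)) s
  have hC : ψ.comp Polynomial.C = algebraMap ℝ ℂ := RingHom.ext fun a => by simp [ψ]
  have hresolvent : ψ.mapMatrix A.charmatrix *ᵥ ℓ = fun i => (b i : ℂ) := by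
    rw [mapMatrix_charmatrix, hC, ← hA.mulVec_laplace_flow hs]
    simp [ψ, ℓ]
  have hadjugate : ψ A.charpoly • ℓ = fun i => ψ (hoNum A b i) := calc
    ψ A.charpoly • ℓ = (ψ.mapMatrix A.charmatrix).adjugate *ᵥ ψ.mapMatrix A.charmatrix *ᵥ ℓ := by
      rw [Matrix.mulVec_mulVec, Matrix.adjugate_mul, ← RingHom.map_det, Matrix.smul_mulVec,
        Matrix.one_mulVec]
      rfl
    _ = fun i => ψ (hoNum A b i) := by
      ext i
      rw [hresolvent, hoNum, RingHom.map_mulVec, ← RingHom.map_adjugate]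
      simp [ψ, Function.comp_def]
  rw [Ho_eq_div, eval_div_algebraMap _ (hA.eval₂_charpoly_ne_zero hs),
    eq_div_iff (hA.eval₂_charpoly_ne_zero hs), mul_comm]
  exact congrFun hadjugate i

lemma IsHurwitz.hasLaplace_flow (hA : IsHurwitz A) :
    HasLaplace (fun t => (flow A b t i : ℂ)) ((Ho A b i).eval (algebraMap ℝ ℂ)) where
  continuousOn := (Complex.continuous_ofReal.comp (continuous_flow_apply A b i)).continuousOn
  integrableOn := (hA.integrableOn_flow b i).ofReal
  laplace_eq _ hs := hA.laplace_flow hs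

lemma IsHurwitz.hasStableResponse_Ho (hA : IsHurwitz A) : HasStableResponse (Ho A b i) :=
  hasStableResponse_of_hasLaplace (fun s hs => eval₂_denom_ne_zero_of_dvd
    (by rw [Ho_eq_div]; exact RatFunc.denom_div_dvd _ _) (hA.eval₂_charpoly_ne_zero hs))
    hA.hasLaplace_flow

lemma IsHurwitz.response_Ho (hA : IsHurwitz A) (w : ℝ → ℝ) {t : ℝ} (ht : 0 ≤ t) :
    response (Ho A b i) w t = conv (fun t => flow A b t i) w t :=
  conv_congr (eqOn_impulseResponse (isImpulseResponse_of_hasLaplace hA.hasLaplace_flow))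
    (fun _ _ => rfl) ht

end TransferFunction

/-! ### The Lyapunov equation -/

section Lyapunov

variable {n : ℕ} {A P Q : Matrix (Fin n) (Fin n) ℝ}

lemma continuousOn_dotProduct {ι : Type*} [Fintype ι] {y w : ℝ → ι → ℝ} {s : Set ℝ}
    (hy : ContinuousOn y s) (hw : ContinuousOn w s) : ContinuousOn (fun t => y t ⬝ᵥ w t) s :=
  (continuous_fst.dotProduct continuous_snd).comp_continuousOn (hy.prodMk hw)

lemma continuousOn_mulVec {ι κ : Type*} [Fintype κ] (P : Matrix ι κ ℝ) {y : ℝ → κ → ℝ}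
    {s : Set ℝ} (hy : ContinuousOn y s) : ContinuousOn (fun t => P *ᵥ y t) s :=
  (continuous_const.matrix_mulVec continuous_id).comp_continuousOn hy

lemma mulVec_dotProduct {ι : Type*} [Fintype ι] (A : Matrix ι ι ℝ) (x w : ι → ℝ) :
    A *ᵥ x ⬝ᵥ w = x ⬝ᵥ Aᵀ *ᵥ w := by
  rw [Matrix.mulVec_transpose, dotProduct_comm, Matrix.dotProduct_mulVec, dotProduct_comm]

lemma mulVec_dotProduct_add_of_lyapunov (hP : Aᵀ * P + P * A = -Q) (x y : Fin n → ℝ) :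
    A *ᵥ x ⬝ᵥ P *ᵥ y + x ⬝ᵥ P *ᵥ (A *ᵥ y) = -(x ⬝ᵥ Q *ᵥ y) := by
  rw [mulVec_dotProduct, ← dotProduct_add, Matrix.mulVec_mulVec, Matrix.mulVec_mulVec,
    ← Matrix.add_mulVec, hP, Matrix.neg_mulVec, dotProduct_neg]

lemma hasDerivWithinAt_dotProduct_mulVec {ι : Type*} [Fintype ι] (P : Matrix ι ι ℝ)
    {y w : ℝ → ι → ℝ} {y' w' : ι → ℝ} {s : Set ℝ} {t : ℝ}
    (hy : HasDerivWithinAt y y' s t) (hw : HasDerivWithinAt w w' s t) :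
    HasDerivWithinAt (fun u => y u ⬝ᵥ P *ᵥ w u) (y' ⬝ᵥ P *ᵥ w t + y t ⬝ᵥ P *ᵥ w') s t := by
  have hPw := (P.mulVecLin.toContinuousLinearMap).hasFDerivAt.comp_hasDerivWithinAt t hw
  have h := HasDerivWithinAt.fun_sum (u := Finset.univ) fun i _ =>
    (hasDerivWithinAt_pi.1 hy i).mul (hasDerivWithinAt_pi.1 hPw i)
  rw [Finset.sum_add_distrib] at h
  exact h

lemma hasDerivAt_flow_dotProduct (hP : Aᵀ * P + P * A = -Q) (x y : Fin n → ℝ) (t : ℝ) :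
    HasDerivAt (fun u => flow A x u ⬝ᵥ P *ᵥ flow A y u) (-(flow A x t ⬝ᵥ Q *ᵥ flow A y t)) t := by
  rw [← mulVec_dotProduct_add_of_lyapunov hP, ← hasDerivWithinAt_univ]
  exact hasDerivWithinAt_dotProduct_mulVec P (hasDerivAt_flow A x t).hasDerivWithinAt
    (hasDerivAt_flow A y t).hasDerivWithinAt

lemma IsHurwitz.tendsto_flow_dotProduct (hA : IsHurwitz A) (P : Matrix (Fin n) (Fin n) ℝ)
    (x y : Fin n → ℝ) : Tendsto (fun u => flow A x u ⬝ᵥ P *ᵥ flow A y u) atTop (𝓝 0) := by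
  have hcont : Continuous fun p : (Fin n → ℝ) × (Fin n → ℝ) => p.1 ⬝ᵥ P *ᵥ p.2 :=
    continuous_fst.dotProduct (continuous_const.matrix_mulVec continuous_snd)
  have hx : Tendsto (flow A x) atTop (𝓝 0) := tendsto_pi_nhds.2 (hA.tendsto_flow x)
  have hy : Tendsto (flow A y) atTop (𝓝 0) := tendsto_pi_nhds.2 (hA.tendsto_flow y)
  simpa [Function.comp_def] using (hcont.tendsto (0, 0)).comp (hx.prodMk_nhds hy)

lemma IsHurwitz.eq_zero_of_lyapunov (hA : IsHurwitz A) (hP : Aᵀ * P + P * A = 0) : P = 0 := by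
  have hform (x y : Fin n → ℝ) : x ⬝ᵥ P *ᵥ y = 0 := by
    have hderiv (t : ℝ) : HasDerivAt (fun u => flow A x u ⬝ᵥ P *ᵥ flow A y u) 0 t := by
      simpa using hasDerivAt_flow_dotProduct (Q := 0) (by rw [hP, neg_zero]) x y t
    have hconst (t : ℝ) : flow A x t ⬝ᵥ P *ᵥ flow A y t = x ⬝ᵥ P *ᵥ y := by
      simpa only [flow_zero] using is_const_of_deriv_eq_zero
        (fun t => (hderiv t).differentiableAt) (fun t => (hderiv t).deriv) t 0
    exact tendsto_nhds_unique tendsto_const_nhds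
      ((hA.tendsto_flow_dotProduct P x y).congr hconst)
  ext i j
  simpa using hform (Pi.single i 1) (Pi.single j 1)

lemma IsHurwitz.transpose_eq_of_lyapunov (hA : IsHurwitz A) (hQ : Qᵀ = Q)
    (hP : Aᵀ * P + P * A = -Q) : Pᵀ = P := by
  have hPT : Aᵀ * Pᵀ + Pᵀ * A = -Q := by
    rw [← hQ, ← Matrix.transpose_neg, ← hP, Matrix.transpose_add, Matrix.transpose_mul,
      Matrix.transpose_mul, Matrix.transpose_transpose, add_comm]
  refine sub_eq_zero.1 (hA.eq_zero_of_lyapunov ?_)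
  rw [mul_sub, sub_mul, sub_add_sub_comm, hPT, hP, sub_self]

lemma IsHurwitz.posDef_of_lyapunov (hA : IsHurwitz A) (hQ : Q.PosDef)
    (hP : Aᵀ * P + P * A = -Q) : P.PosDef := by
  refine .of_dotProduct_mulVec_pos (hA.transpose_eq_of_lyapunov hQ.isHermitian.eq hP)
    fun x hx => ?_
  have hanti : StrictAnti fun u => flow A x u ⬝ᵥ P *ᵥ flow A x u :=
    strictAnti_of_deriv_neg fun t => by
      rw [(hasDerivAt_flow_dotProduct hP x x t).deriv, neg_lt_zero]
      exact hQ.dotProduct_mulVec_pos (flow_ne_zero hx t)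
  calc 0 ≤ flow A x 1 ⬝ᵥ P *ᵥ flow A x 1 :=
        hanti.antitone.le_of_tendsto (hA.tendsto_flow_dotProduct P x x) 1
    _ < flow A x 0 ⬝ᵥ P *ᵥ flow A x 0 := hanti zero_lt_one
    _ = star x ⬝ᵥ P *ᵥ x := by rw [flow_zero, star_trivial]

lemma exists_mul_norm_sq_le_of_posDef {ι : Type*} [Fintype ι] {P : Matrix ι ι ℝ}
    (hP : P.PosDef) : ∃ m : ℝ, 0 < m ∧ ∀ x : ι → ℝ, m * ‖x‖ ^ 2 ≤ x ⬝ᵥ P *ᵥ x := by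
  rcases subsingleton_or_nontrivial (ι → ℝ) with hι | hι
  · exact ⟨1, one_pos, fun x => by simp [Subsingleton.elim x 0]⟩
  have hcont : Continuous fun x : ι → ℝ => x ⬝ᵥ P *ᵥ x :=
    continuous_id.dotProduct (continuous_const.matrix_mulVec continuous_id)
  obtain ⟨e, he, hmin⟩ := (isCompact_sphere (0 : ι → ℝ) 1).exists_isMinOn
    (NormedSpace.sphere_nonempty.2 zero_le_one) hcont.continuousOn
  refine ⟨e ⬝ᵥ P *ᵥ e, hP.dotProduct_mulVec_pos (ne_zero_of_mem_unit_sphere ⟨e, he⟩),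
    fun x => ?_⟩
  rcases eq_or_ne x 0 with rfl | hx
  · simp
  have hnorm : ‖x‖ ≠ 0 := norm_ne_zero_iff.2 hx
  calc e ⬝ᵥ P *ᵥ e * ‖x‖ ^ 2
      ≤ (‖x‖⁻¹ • x) ⬝ᵥ P *ᵥ (‖x‖⁻¹ • x) * ‖x‖ ^ 2 := by
        gcongr
        exact hmin (by simp [norm_smul, hnorm])
    _ = x ⬝ᵥ P *ᵥ x := by
        simp only [Matrix.mulVec_smul, dotProduct_smul, smul_dotProduct, smul_eq_mul]
        field_simp

end Lyapunov

/-! ### Carathéodory trajectories -/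

/-- `z` is a locally absolutely continuous curve on `[0, ∞)` with almost everywhere derivative `v`,
in integrated form. This is the sense in which the adaptive law, whose right-hand side is
discontinuous, is solved. -/
structure HasVelocity {E : Type*} [NormedAddCommGroup E] [NormedSpace ℝ E] (z v : ℝ → E) :
    Prop where
  integrableOn : ∀ T, 0 ≤ T → IntegrableOn v (Icc 0 T)
  eq_add_integral : ∀ t, 0 ≤ t → z t = z 0 + ∫ τ in (0 : ℝ)..t, v τ

namespace HasVelocity

variable {E F : Type*} [NormedAddCommGroup E] [NormedSpace ℝ E] [NormedAddCommGroup F]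
  [NormedSpace ℝ F] {z w v v' : ℝ → E} {a b t : ℝ}

lemma intervalIntegrable (h : HasVelocity z v) (ha : 0 ≤ a) (hab : a ≤ b) :
    IntervalIntegrable v volume a b := by
  rw [intervalIntegrable_iff_integrableOn_Ioc_of_le hab]
  exact (h.integrableOn b (ha.trans hab)).mono_set fun t ht => ⟨ha.trans ht.1.le, ht.2⟩

lemma integral_eq_sub (h : HasVelocity z v) (ha : 0 ≤ a) (hab : a ≤ b) :
    ∫ τ in a..b, v τ = z b - z a := by
  rw [h.eq_add_integral b (ha.trans hab), h.eq_add_integral a ha, add_sub_add_left_eq_sub,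
    intervalIntegral.integral_interval_sub_left (h.intervalIntegrable le_rfl (ha.trans hab))
      (h.intervalIntegrable le_rfl ha)]

lemma continuousOn (h : HasVelocity z v) : ContinuousOn z (Ici 0) := by
  intro t ht
  have hprim := intervalIntegral.continuousOn_primitive_interval' (a := 0)
    (h.intervalIntegrable le_rfl (add_nonneg ht zero_le_one)) left_mem_uIcc
  rw [uIcc_of_le (add_nonneg ht zero_le_one)] at hprim
  have hz : ContinuousOn z (Icc 0 (t + 1)) :=
    (hprim.const_add (z 0)).congr fun τ hτ => h.eq_add_integral τ hτ.1
  refine (hz t ⟨ht, by linarith⟩).mono_of_mem_nhdsWithin ?_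
  rw [← Ici_inter_Iic]
  exact inter_mem self_mem_nhdsWithin (nhdsWithin_le_nhds (Iic_mem_nhds (by linarith)))

lemma of_hasDerivWithinAt [CompleteSpace E]
    (hz : ∀ t, 0 ≤ t → HasDerivWithinAt z (v t) (Ici 0) t) (hv : ContinuousOn v (Ici 0)) :
    HasVelocity z v where
  integrableOn T _ := (hv.mono Icc_subset_Ici_self).integrableOn_Icc
  eq_add_integral t ht := by
    rw [intervalIntegral.integral_eq_sub_of_hasDerivAt_of_le ht
      (fun τ hτ => (hz τ hτ.1).continuousWithinAt.mono Icc_subset_Ici_self)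
      (fun τ hτ => (hz τ hτ.1.le).hasDerivAt (Ici_mem_nhds hτ.1))
      ((hv.mono Icc_subset_Ici_self).intervalIntegrable_of_Icc ht), add_sub_cancel]

lemma add (hz : HasVelocity z v) (hw : HasVelocity w v') : HasVelocity (z + w) (v + v') where
  integrableOn T hT := (hz.integrableOn T hT).add (hw.integrableOn T hT)
  eq_add_integral t ht := by
    simp only [Pi.add_apply]
    rw [intervalIntegral.integral_add (hz.intervalIntegrable le_rfl ht)
      (hw.intervalIntegrable le_rfl ht), hz.eq_add_integral t ht, hw.eq_add_integral t ht]
    abel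

lemma const_smul (c : ℝ) (hz : HasVelocity z v) : HasVelocity (c • z) (c • v) where
  integrableOn T hT := (hz.integrableOn T hT).smul c
  eq_add_integral t ht := by
    simp only [Pi.smul_apply]
    rw [intervalIntegral.integral_smul, hz.eq_add_integral t ht, smul_add]

lemma sub_const (hz : HasVelocity z v) (c : E) : HasVelocity (fun t => z t - c) v where
  integrableOn := hz.integrableOn
  eq_add_integral t ht := by rw [hz.eq_add_integral t ht, sub_add_eq_add_sub]

lemma clm_comp [CompleteSpace E] [CompleteSpace F] (L : E →L[ℝ] F) (hz : HasVelocity z v) :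
    HasVelocity (fun t => L (z t)) (fun t => L (v t)) where
  integrableOn T hT := L.integrable_comp (hz.integrableOn T hT)
  eq_add_integral t ht := by
    rw [L.intervalIntegral_comp_comm (hz.intervalIntegrable le_rfl ht), hz.eq_add_integral t ht,
      map_add]

lemma sum {ι : Type*} {z v : ι → ℝ → E} (s : Finset ι) (h : ∀ i ∈ s, HasVelocity (z i) (v i)) :
    HasVelocity (fun t => ∑ i ∈ s, z i t) (fun t => ∑ i ∈ s, v i t) where
  integrableOn T hT := integrable_finsetSum s fun i hi => (h i hi).integrableOn T hT
  eq_add_integral t ht := by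
    rw [intervalIntegral.integral_finsetSum fun i hi => (h i hi).intervalIntegrable le_rfl ht,
      ← Finset.sum_add_distrib]
    exact Finset.sum_congr rfl fun i hi => (h i hi).eq_add_integral t ht

lemma mul {z w v v' : ℝ → ℝ} (hz : HasVelocity z v) (hw : HasVelocity w v') :
    HasVelocity (fun t => z t * w t) (fun t => v t * w t + z t * v' t) where
  integrableOn T hT :=
    ((hz.integrableOn T hT).mul_continuousOn (hw.continuousOn.mono Icc_subset_Ici_self)
      isCompact_Icc).add
    ((hw.integrableOn T hT).continuousOn_mul (hz.continuousOn.mono Icc_subset_Ici_self)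
      isCompact_Icc)
  eq_add_integral t ht := by
    have hac {z v : ℝ → ℝ} (h : HasVelocity z v) :
        AbsolutelyContinuousOnInterval (fun s => z 0 + ∫ τ in (0 : ℝ)..s, v τ) 0 t :=
      (LipschitzWith.const (z 0)).lipschitzOnWith.absolutelyContinuousOnInterval.fun_add
        ((h.intervalIntegrable le_rfl ht).absolutelyContinuousOnInterval_intervalIntegral
          left_mem_uIcc)
    have hderiv {z v : ℝ → ℝ} (h : HasVelocity z v) : ∀ᵐ s, s ∈ uIoc 0 t →
        deriv (fun s => z 0 + ∫ τ in (0 : ℝ)..s, v τ) s = v s := by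
      filter_upwards [(h.intervalIntegrable le_rfl ht).ae_hasDerivAt_integral] with s hs hst
      exact ((hs (uIoc_subset_uIcc hst) 0 left_mem_uIcc).const_add _).deriv
    have hparts := (hac hz).integral_deriv_mul_eq_sub (hac hw)
    simp only [intervalIntegral.integral_same, add_zero] at hparts
    rw [hz.eq_add_integral t ht, hw.eq_add_integral t ht, ← sub_eq_iff_eq_add', ← hparts]
    refine intervalIntegral.integral_congr_ae ?_
    filter_upwards [hderiv hz, hderiv hw] with s hzs hws hs
    have hs0 : 0 ≤ s := (uIoc_of_le ht ▸ hs).1.le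
    rw [hzs hs, hws hs, ← hz.eq_add_integral s hs0, ← hw.eq_add_integral s hs0]

lemma dotProduct {ι : Type*} [Fintype ι] {z w v v' : ℝ → ι → ℝ} (hz : HasVelocity z v)
    (hw : HasVelocity w v') :
    HasVelocity (fun t => z t ⬝ᵥ w t) (fun t => v t ⬝ᵥ w t + z t ⬝ᵥ v' t) := by
  have happly {z v : ℝ → ι → ℝ} (h : HasVelocity z v) (i : ι) :
      HasVelocity (fun t => z t i) (fun t => v t i) :=
    h.clm_comp (ContinuousLinearMap.proj (R := ℝ) (φ := fun _ : ι => ℝ) i)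
  simpa only [_root_.dotProduct, Finset.sum_add_distrib] using
    sum Finset.univ fun i _ => (happly hz i).mul (happly hw i)

lemma sub_le_integral {f v g : ℝ → ℝ} (hf : HasVelocity f v) (ha : 0 ≤ a) (hab : a ≤ b)
    (hg : IntervalIntegrable g volume a b) (hvg : ∀ᵐ t ∂volume.restrict (Icc a b), v t ≤ g t) :
    f b - f a ≤ ∫ t in a..b, g t :=
  hf.integral_eq_sub ha hab ▸
    intervalIntegral.integral_mono_ae_restrict hab (hf.intervalIntegrable ha hab) hg hvg

lemma le_of_forall_le_imp_nonpos {f v : ℝ → ℝ} {u : ℝ} (hf : HasVelocity f v) (h0 : f 0 ≤ u)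
    (hv : ∀ᵐ t ∂volume.restrict (Ici 0), u ≤ f t → v t ≤ 0) (ht : 0 ≤ t) : f t ≤ u := by
  by_contra! hlt
  obtain ⟨s, ⟨⟨hs0, hst⟩, hsu⟩, hlast⟩ : ∃ s, IsGreatest (Icc 0 t ∩ f ⁻¹' Iic u) s :=
    (isCompact_Icc.of_isClosed_subset ((hf.continuousOn.mono Icc_subset_Ici_self)
      |>.preimage_isClosed_of_isClosed isClosed_Icc isClosed_Iic) inter_subset_left)
      |>.exists_isGreatest ⟨0, ⟨le_rfl, ht⟩, h0⟩
  have habove (τ : ℝ) (hτ : τ ∈ Ioc s t) : u < f τ := by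
    by_contra! hle
    exact hτ.1.not_ge (hlast ⟨⟨hs0.trans hτ.1.le, hτ.2⟩, hle⟩)
  have hnonpos : ∀ᵐ τ ∂volume.restrict (Icc s t), v τ ≤ 0 := by
    rw [← restrict_Ioc_eq_restrict_Icc]
    filter_upwards [ae_restrict_of_ae_restrict_of_subset (fun τ hτ => hs0.trans hτ.1.le) hv,
      ae_restrict_mem measurableSet_Ioc] with τ hvτ hτ using hvτ (habove τ hτ).le
  have hdecr := hf.sub_le_integral hs0 hst intervalIntegrable_const hnonpos
  rw [intervalIntegral.integral_zero] at hdecr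
  have hs : f s ≤ u := hsu
  linarith

end HasVelocity

/-! ### The projected adaptive law -/

section AdaptiveLaw

variable {n : ℕ} {Ω : Set (Fin n → ℝ)} {z v y θ : Fin n → ℝ}

lemma smul_mem_tangentCone (hv : v ∈ tangentCone Ω z) {c : ℝ} (hc : 0 ≤ c) :
    c • v ∈ tangentCone Ω z := by
  refine map_mem_closure (continuous_const_smul c) hv ?_
  rintro _ ⟨s, hs, w, hw, rfl⟩
  exact ⟨c * s, mul_nonneg hc hs, w, hw, smul_smul c s _⟩

lemma add_smul_mem_tangentCone (hΩ : Convex ℝ Ω) (hv : v ∈ tangentCone Ω z) (hθ : θ ∈ Ω) {ε : ℝ}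
    (hε : 0 < ε) : v + ε • (θ - z) ∈ tangentCone Ω z := by
  refine map_mem_closure (f := fun w => w + ε • (θ - z)) (by fun_prop) hv ?_
  rintro _ ⟨s, hs, w, hw, rfl⟩
  have hsε : 0 < s + ε := by positivity
  refine ⟨s + ε, hsε.le, (s / (s + ε)) • w + (ε / (s + ε)) • θ,
    hΩ hw hθ (by positivity) (by positivity) (by field_simp), ?_⟩
  match_scalars <;> field_simp
  ring

lemma apply_nonpos_of_mem_tangentCone (f : (Fin n → ℝ) →L[ℝ] ℝ) (hf : ∀ w ∈ Ω, f w ≤ f z)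
    (hv : v ∈ tangentCone Ω z) : f v ≤ 0 := by
  refine closure_minimal ?_ (isClosed_le f.continuous continuous_const) hv
  rintro _ ⟨s, hs, w, hw, rfl⟩
  rw [mem_ofPred, map_smul, map_sub]
  exact mul_nonpos_of_nonneg_of_nonpos hs (sub_nonpos.2 (hf w hw))

lemma HasVelocity.mem_of_mem_tangentCone {z v : ℝ → Fin n → ℝ} (hz : HasVelocity z v)
    (hΩc : IsClosed Ω) (hΩ : Convex ℝ Ω) (h0 : z 0 ∈ Ω)
    (hv : ∀ᵐ t ∂volume.restrict (Ici 0), v t ∈ tangentCone Ω (z t)) {t : ℝ} (ht : 0 ≤ t) :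
    z t ∈ Ω := by
  by_contra hnot
  obtain ⟨f, u, hfu, hu⟩ := geometric_hahn_banach_closed_point hΩ hΩc hnot
  refine hu.not_ge ((hz.clm_comp f).le_of_forall_le_imp_nonpos (hfu _ h0).le ?_ ht)
  filter_upwards [hv] with τ hτ hle
  exact apply_nonpos_of_mem_tangentCone f (fun w hw => (hfu w hw).le.trans hle) hτ

lemma IsProj.dotProduct_nonpos (hΩ : Convex ℝ Ω) (h : IsProj Ω z y v) (hθ : θ ∈ Ω) :
    (y - v) ⬝ᵥ (θ - z) ≤ 0 := by
  have hbound (ε : ℝ) (hε : 0 < ε) :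
      2 * ((y - v) ⬝ᵥ (θ - z)) ≤ ε * ((θ - z) ⬝ᵥ (θ - z)) := by
    have hmin := h.2 _ (add_smul_mem_tangentCone hΩ h.1 hθ hε)
    have hexpand : ∑ i, (y i - (v + ε • (θ - z)) i) ^ 2 = ∑ i, (y i - v i) ^ 2
        - ε * (2 * ((y - v) ⬝ᵥ (θ - z))) + ε * (ε * ((θ - z) ⬝ᵥ (θ - z))) := by
      simp only [dotProduct, Finset.mul_sum, ← Finset.sum_sub_distrib, ← Finset.sum_add_distrib]
      refine Finset.sum_congr rfl fun i _ => ?_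
      simp only [Pi.add_apply, Pi.smul_apply, Pi.sub_apply, smul_eq_mul]
      ring
    exact le_of_mul_le_mul_left (by linarith) hε
  have hlim : Tendsto (fun ε : ℝ => ε * ((θ - z) ⬝ᵥ (θ - z))) (𝓝[>] 0) (𝓝 0) :=
    ((continuous_mul_const _).tendsto' 0 0 (zero_mul _)).mono_left nhdsWithin_le_nhds
  have h2 := ge_of_tendsto hlim (eventually_mem_nhdsWithin.mono hbound)
  linarith

/-- The Lyapunov function `V = eᵀ P e + δᵀ δ / Γ` of the prediction error `e` and the parameter
error `δ`. -/
def lyapunovFun (P : Matrix (Fin n) (Fin n) ℝ) (Γ : ℝ) (e δ : Fin n → ℝ) : ℝ :=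
  e ⬝ᵥ P *ᵥ e + Γ⁻¹ * (δ ⬝ᵥ δ)

lemma dotProduct_mulVec_le_lyapunovFun (P : Matrix (Fin n) (Fin n) ℝ) {Γ : ℝ} (hΓ : 0 ≤ Γ)
    (e δ : Fin n → ℝ) : e ⬝ᵥ P *ᵥ e ≤ lyapunovFun P Γ e δ :=
  le_add_of_nonneg_right (mul_nonneg (inv_nonneg.2 hΓ) (dotProduct_star_self_nonneg δ))

variable {A P Q : Matrix (Fin n) (Fin n) ℝ} {b : Fin n → ℝ} {Γ : ℝ}

-- The cross terms `± 2 (e ⬝ᵥ P *ᵥ b) (δ ⬝ᵥ x)` of the two errors cancel: this is how the adaptive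
-- law is chosen, and the projection only helps.
lemma lyapunovFun_rate_le (hPT : Pᵀ = P) (hP : Aᵀ * P + P * A = -Q) (hΩ : Convex ℝ Ω)
    (hθ : θ ∈ Ω) (hΓ : Γ ≠ 0) {e e' x : Fin n → ℝ} (he' : e' = A *ᵥ e - ((z - θ) ⬝ᵥ x) • b)
    (hv : IsProj Ω z ((e ⬝ᵥ P *ᵥ b) • x) v) :
    (e' ⬝ᵥ P *ᵥ e + e ⬝ᵥ P *ᵥ e') + Γ⁻¹ * ((Γ • v) ⬝ᵥ (z - θ) + (z - θ) ⬝ᵥ (Γ • v))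
      ≤ -(e ⬝ᵥ Q *ᵥ e) := by
  have hsymm : b ⬝ᵥ P *ᵥ e = e ⬝ᵥ P *ᵥ b := by
    rw [dotProduct_comm, mulVec_dotProduct, hPT]
  have hstate : e' ⬝ᵥ P *ᵥ e + e ⬝ᵥ P *ᵥ e'
      = -(e ⬝ᵥ Q *ᵥ e) - 2 * (((z - θ) ⬝ᵥ x) * (e ⬝ᵥ P *ᵥ b)) := by
    rw [he', ← mulVec_dotProduct_add_of_lyapunov hP, sub_dotProduct, Matrix.mulVec_sub,
      dotProduct_sub, Matrix.mulVec_smul, dotProduct_smul, smul_dotProduct, hsymm]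
    simp only [smul_eq_mul]
    ring
  have hparameter : Γ⁻¹ * ((Γ • v) ⬝ᵥ (z - θ) + (z - θ) ⬝ᵥ (Γ • v)) = 2 * ((z - θ) ⬝ᵥ v) := by
    rw [smul_dotProduct, dotProduct_smul, dotProduct_comm v, smul_eq_mul]
    field_simp
    ring
  have hproj : (z - θ) ⬝ᵥ v ≤ ((z - θ) ⬝ᵥ x) * (e ⬝ᵥ P *ᵥ b) := by
    have h := hv.dotProduct_nonpos hΩ hθ
    rw [← neg_sub z θ, dotProduct_neg, sub_dotProduct, smul_dotProduct, smul_eq_mul,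
      dotProduct_comm x, dotProduct_comm v] at h
    linarith
  rw [hstate, hparameter]
  linarith

lemma lyapunovFun_add_integral_le (hPT : Pᵀ = P) (hP : Aᵀ * P + P * A = -Q) (hΩ : Convex ℝ Ω)
    (hθ : θ ∈ Ω) (hΓ : Γ ≠ 0) {x e z v : ℝ → Fin n → ℝ} (hx : ContinuousOn x (Ici 0))
    (he : ∀ t, 0 ≤ t → HasDerivWithinAt e (A *ᵥ e t - ((z t - θ) ⬝ᵥ x t) • b) (Ici 0) t)
    (hz : HasVelocity z (Γ • v))
    (hv : ∀ᵐ t ∂volume.restrict (Ici 0), IsProj Ω (z t) ((e t ⬝ᵥ P *ᵥ b) • x t) (v t))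
    {T : ℝ} (hT : 0 ≤ T) :
    lyapunovFun P Γ (e T) (z T - θ) + ∫ t in (0 : ℝ)..T, e t ⬝ᵥ Q *ᵥ e t
      ≤ lyapunovFun P Γ (e 0) (z 0 - θ) := by
  have hec : ContinuousOn e (Ici 0) := fun t ht => (he t ht).continuousWithinAt
  have hev := HasVelocity.of_hasDerivWithinAt he <|
    (continuousOn_mulVec A hec).sub <|
      (continuousOn_dotProduct (hz.continuousOn.sub continuousOn_const) hx).smul continuousOn_const
  have hδ := hz.sub_const θ
  have hV := (hev.dotProduct (hev.clm_comp P.mulVecLin.toContinuousLinearMap)).add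
    ((hδ.dotProduct hδ).const_smul Γ⁻¹)
  have hQ : IntervalIntegrable (fun t => -(e t ⬝ᵥ Q *ᵥ e t)) volume 0 T :=
    ((continuousOn_dotProduct hec (continuousOn_mulVec Q hec)).mono
      Icc_subset_Ici_self).intervalIntegrable_of_Icc hT |>.neg
  have hdecr := hV.sub_le_integral le_rfl hT hQ <| by
    filter_upwards [ae_restrict_of_ae_restrict_of_subset Icc_subset_Ici_self hv] with t ht
    exact lyapunovFun_rate_le hPT hP hΩ hθ hΓ rfl ht
  rw [intervalIntegral.integral_neg] at hdecr
  change lyapunovFun P Γ (e T) (z T - θ) - lyapunovFun P Γ (e 0) (z 0 - θ) ≤ _ at hdecr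
  linarith

end AdaptiveLaw

/-! ### Small gain and convergence -/

section SmallGain

lemma norm_le_of_small_gain {E : Type*} [NormedAddCommGroup E] {y : ℝ → E}
    (hy : ContinuousOn y (Ici 0)) {a q : ℝ} (hq : q < 1)
    (h : ∀ t, 0 ≤ t → ∀ B, (∀ τ ∈ Icc 0 t, ‖y τ‖ ≤ B) → ‖y t‖ ≤ a + q * B) {t : ℝ}
    (ht : 0 ≤ t) : ‖y t‖ ≤ a / (1 - q) := by
  obtain ⟨s, hs, hmax⟩ := isCompact_Icc.exists_isMaxOn (nonempty_Icc.2 ht)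
    (hy.mono Icc_subset_Ici_self).norm
  have hgain := h s hs.1 ‖y s‖ fun τ hτ => hmax ⟨hτ.1, hτ.2.trans hs.2⟩
  calc ‖y t‖ ≤ ‖y s‖ := hmax ⟨ht, le_rfl⟩
    _ ≤ a / (1 - q) := by
      rw [le_div_iff₀ (by linarith)]
      linarith

lemma abs_dotProduct_le {ι : Type*} [Fintype ι] (z x : ι → ℝ) :
    |z ⬝ᵥ x| ≤ (∑ i, |z i|) * ‖x‖ := by
  rw [dotProduct, Finset.sum_mul]
  refine (Finset.abs_sum_le_sum_abs _ _).trans (Finset.sum_le_sum fun i _ => ?_)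
  rw [abs_mul]
  exact mul_le_mul_of_nonneg_left (norm_le_pi_norm x i) (abs_nonneg _)

variable {n : ℕ} {Ω : Set (Fin n → ℝ)}

lemma thetaMax_nonneg (Ω : Set (Fin n → ℝ)) : 0 ≤ thetaMax Ω := by
  refine Real.sSup_nonneg ?_
  rintro _ ⟨z, -, rfl⟩
  exact Finset.sum_nonneg fun i _ => abs_nonneg (z i)

lemma abs_dotProduct_le_thetaMax (hΩ : IsCompact Ω) {z : Fin n → ℝ} (hz : z ∈ Ω)
    {x : Fin n → ℝ} {B : ℝ} (hx : ‖x‖ ≤ B) : |z ⬝ᵥ x| ≤ thetaMax Ω * B := by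
  have hsum : ∑ i, |z i| ≤ thetaMax Ω :=
    le_csSup (hΩ.image (by fun_prop)).bddAbove ⟨z, hz, rfl⟩
  exact (abs_dotProduct_le z x).trans
    (mul_le_mul hsum hx (norm_nonneg x) (thetaMax_nonneg Ω))

lemma ofReal_integral_abs_le_l1Gain {m : ℕ} {H : Matrix (Fin n) (Fin m) (RatFunc ℝ)} {i : Fin n}
    {j : Fin m} (hH : HasStableResponse (H i j)) :
    ENNReal.ofReal (∫ t in Ioi (0 : ℝ), |impulseResponse (H i j) t|) ≤ l1Gain H := by
  rw [ofReal_integral_eq_lintegral_ofReal hH.integrableOn.abs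
    (Eventually.of_forall fun _ => abs_nonneg _), l1Gain]
  exact (Finset.single_le_sum_of_canonicallyOrdered
    (f := fun j => ∫⁻ t in Ioi (0 : ℝ), ENNReal.ofReal |impulseResponse (H i j) t|)
    (Finset.mem_univ j)).trans
      (le_iSup (fun i => ∑ j, ∫⁻ t in Ioi (0 : ℝ), ENNReal.ofReal |impulseResponse (H i j) t|) i)

lemma abs_response_dotProduct_le {m : ℕ} {H : Matrix (Fin n) (Fin m) (RatFunc ℝ)} {i : Fin n}
    {j : Fin m} (hH : HasStableResponse (H i j)) {k : ℕ} {Ω : Set (Fin k → ℝ)}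
    (hΩ : IsCompact Ω) (hgain : l1Gain H * ENNReal.ofReal (thetaMax Ω) ≠ ⊤)
    {z x : ℝ → Fin k → ℝ} {t B : ℝ} (ht : 0 ≤ t) (hz : ∀ τ ∈ Icc 0 t, z τ ∈ Ω)
    (hx : ∀ τ ∈ Icc 0 t, ‖x τ‖ ≤ B) :
    |response (H i j) (fun τ => z τ ⬝ᵥ x τ) t|
      ≤ (l1Gain H * ENNReal.ofReal (thetaMax Ω)).toReal * B := by
  have hB : 0 ≤ B := (norm_nonneg _).trans (hx 0 ⟨le_rfl, ht⟩)
  have hloop : (∫ τ in Ioi 0, |impulseResponse (H i j) τ|) * thetaMax Ω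
      ≤ (l1Gain H * ENNReal.ofReal (thetaMax Ω)).toReal := by
    rw [← ENNReal.ofReal_le_iff_le_toReal hgain, ENNReal.ofReal_mul' (thetaMax_nonneg Ω)]
    gcongr
    exact ofReal_integral_abs_le_l1Gain hH
  calc |response (H i j) (fun τ => z τ ⬝ᵥ x τ) t|
      ≤ (∫ τ in Ioi 0, |impulseResponse (H i j) τ|) * (thetaMax Ω * B) :=
        hH.abs_response_le ht fun τ hτ => abs_dotProduct_le_thetaMax hΩ (hz τ hτ) (hx τ hτ)
    _ = ((∫ τ in Ioi 0, |impulseResponse (H i j) τ|) * thetaMax Ω) * B := (mul_assoc _ _ _).symm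
    _ ≤ (l1Gain H * ENNReal.ofReal (thetaMax Ω)).toReal * B :=
        mul_le_mul_of_nonneg_right hloop hB

end SmallGain

section Barbalat

lemma integrableOn_Ioi_of_integral_le {f : ℝ → ℝ} (hf : ContinuousOn f (Ici 0))
    (hf0 : ∀ t, 0 ≤ t → 0 ≤ f t) {I : ℝ} (hI : ∀ T, 0 ≤ T → ∫ t in (0 : ℝ)..T, f t ≤ I) :
    IntegrableOn f (Ioi 0) := by
  refine integrableOn_Ioi_of_intervalIntegral_norm_bounded (l := atTop) (b := id) I 0
    (fun T => ?_) tendsto_id ?_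
  · exact (hf.mono Icc_subset_Ici_self).integrableOn_Icc.mono_set Ioc_subset_Icc_self
  · filter_upwards [eventually_ge_atTop 0] with T hT
    rw [intervalIntegral.integral_congr fun t ht => ?_]
    · exact hI T hT
    · rw [id, uIcc_of_le hT] at ht
      exact Real.norm_of_nonneg (hf0 t ht.1)

lemma tendsto_zero_of_tendsto_pow {l : Filter ℝ} {f : ℝ → ℝ} {k : ℕ} (hk : k ≠ 0)
    (hf : Tendsto (fun t => f t ^ k) l (𝓝 0)) : Tendsto f l (𝓝 0) := by
  rw [tendsto_zero_iff_abs_tendsto_zero] at hf ⊢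
  have hroot := hf.rpow_const (p := (k : ℝ)⁻¹) (Or.inr (by positivity))
  rw [Real.zero_rpow (by positivity)] at hroot
  refine hroot.congr fun t => ?_
  rw [Function.comp_apply, Function.comp_apply, abs_pow,
    Real.pow_rpow_inv_natCast (abs_nonneg _) hk]

lemma tendsto_zero_of_integrableOn_sq {f f' : ℝ → ℝ}
    (hf : ∀ t, 0 ≤ t → HasDerivWithinAt f (f' t) (Ici 0) t) {B D : ℝ}
    (hB : ∀ t, 0 ≤ t → |f t| ≤ B) (hD : ∀ t, 0 ≤ t → |f' t| ≤ D)
    (hsq : IntegrableOn (fun t => f t ^ 2) (Ioi 0)) : Tendsto f atTop (𝓝 0) := by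
  have hderiv : ∀ t ∈ Ioi (0 : ℝ), HasDerivAt f (f' t) t := fun t ht =>
    (hf t (le_of_lt ht)).hasDerivAt (Ici_mem_nhds ht)
  have hmeas : AEStronglyMeasurable f (volume.restrict (Ioi 0)) :=
    ContinuousOn.aestronglyMeasurable
      (fun t ht => (hderiv t ht).continuousAt.continuousWithinAt) measurableSet_Ioi
  have hmeas' : AEStronglyMeasurable f' (volume.restrict (Ioi 0)) :=
    (stronglyMeasurable_deriv f).aestronglyMeasurable.congr <|
      (ae_restrict_iff' measurableSet_Ioi).2 (.of_forall fun t ht => (hderiv t ht).deriv)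
  have hbound {g : ℝ → ℝ} {M : ℝ} (hg : ∀ t, 0 ≤ t → |g t| ≤ M) :
      ∀ᵐ t ∂volume.restrict (Ioi 0), ‖g t‖ ≤ M :=
    (ae_restrict_iff' measurableSet_Ioi).2 (.of_forall fun t ht => hg t (le_of_lt ht))
  -- The square need not have an integrable derivative; the cube has, namely `3 * f ^ 2 * f'`.
  refine tendsto_zero_of_tendsto_pow three_ne_zero ?_
  refine tendsto_zero_of_hasDerivAt_of_integrableOn_Ioi (a := 0)
    (f' := fun t => 3 * (f' t * f t ^ 2)) (fun t ht => ?_) ?_ ?_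
  · exact ((hderiv t ht).pow 3).congr_deriv (by push_cast; ring)
  · exact (Integrable.bdd_mul hsq hmeas' (hbound hD)).const_mul 3
  · exact (Integrable.bdd_mul hsq hmeas (hbound hB)).congr
      (.of_forall fun t => (pow_succ' (f t) 2).symm)

end Barbalat

/-! ### The closed loop -/

section Predictor

variable {n : ℕ} {A : Matrix (Fin n) (Fin n) ℝ} {b : Fin n → ℝ} {C : RatFunc ℝ}

lemma Gbar_apply_eq_sub (i : Fin n) (j : Fin 1) :
    Gbar A b C i j = Ho A b i * C - Ho A b i := by
  rw [Gbar, Matrix.of_apply, mul_sub, mul_one]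

lemma hasStableResponse_Gbar (hA : IsHurwitz A) (hC : HasStableResponse C) (i : Fin n)
    (j : Fin 1) : HasStableResponse (Gbar A b C i j) := by
  rw [Gbar_apply_eq_sub]
  exact (hA.hasStableResponse_Ho.mul hC).sub hA.hasStableResponse_Ho

lemma predictor_apply_eq (hA : IsHurwitz A) (hC : HasStableResponse C) {y : ℝ → Fin n → ℝ}
    {ρ ν : ℝ → ℝ} (hρ : ContinuousOn ρ (Ici 0)) (hν : ContinuousOn ν (Ici 0))
    (hy : ∀ t, 0 ≤ t → HasDerivWithinAt y
      (A *ᵥ y t + (response C (ρ + ν) t - ρ t) • b) (Ici 0) t)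
    (i : Fin n) {t : ℝ} (ht : 0 ≤ t) :
    y t i = flow A (y 0) t i + response (Gbar A b C i 0) ρ t + response (Ho A b i * C) ν t := by
  have hH : HasStableResponse (Ho A b i) := hA.hasStableResponse_Ho
  have hu := hC.continuousOn_response (hρ.add hν)
  rw [eq_flow_add_conv i (hu.sub hρ) hy ht, add_assoc]
  congr 1
  calc conv (fun t => flow A b t i) (response C (ρ + ν) - ρ) t
      = response (Ho A b i) (response C (ρ + ν) - ρ) t := (hA.response_Ho _ ht).symm
    _ = response (Ho A b i * C) (ρ + ν) t - response (Ho A b i) ρ t := by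
        rw [hH.response_sub_right hu hρ ht, hH.response_mul hC (hρ.add hν) ht]
    _ = response (Gbar A b C i 0) ρ t + response (Ho A b i * C) ν t := by
        rw [(hH.mul hC).response_add_right hρ hν ht, Gbar_apply_eq_sub,
          (hH.mul hC).response_sub hH hρ ht]
        ring

lemma exists_abs_flow_add_response_le (hA : IsHurwitz A) {H : RatFunc ℝ}
    (hH : HasStableResponse H) {v : ℝ → ℝ} {B : ℝ} (hB : ∀ t, 0 ≤ t → |v t| ≤ B)
    (x : Fin n → ℝ) (i : Fin n) : ∃ N, ∀ t, 0 ≤ t → |flow A x t i + response H v t| ≤ N := by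
  obtain ⟨N, hN⟩ := exists_norm_le_of_tendsto
    (continuous_flow_apply A x i).continuousOn (hA.tendsto_flow x i)
  exact ⟨_, fun t ht => (abs_add_le _ _).trans <|
    add_le_add (hN t ht) (hH.abs_response_le ht fun τ hτ => hB τ hτ.1)⟩

end Predictor

lemma abs_error_deriv_le {n : ℕ} {A : Matrix (Fin n) (Fin n) ℝ} {b : Fin n → ℝ}
    {Ω : Set (Fin n → ℝ)} (hΩ : IsCompact Ω) {e y z θ : Fin n → ℝ}
    (hz : z ∈ Ω) (hθ : θ ∈ Ω) {E M : ℝ} (he : ‖e‖ ≤ E) (hy : ‖y‖ ≤ M) (i : Fin n) :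
    |(A *ᵥ e - ((z - θ) ⬝ᵥ y) • b) i|
      ≤ (∑ j, |A i j|) * E + (thetaMax Ω * M + thetaMax Ω * M) * |b i| := by
  have hlinear : |(A *ᵥ e) i| ≤ (∑ j, |A i j|) * E :=
    (abs_dotProduct_le (A i) e).trans
      (mul_le_mul_of_nonneg_left he (Finset.sum_nonneg fun _ _ => abs_nonneg _))
  have hparameter : |(z - θ) ⬝ᵥ y| ≤ thetaMax Ω * M + thetaMax Ω * M := by
    rw [sub_dotProduct]
    exact (abs_sub _ _).trans (add_le_add (abs_dotProduct_le_thetaMax hΩ hz hy)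
      (abs_dotProduct_le_thetaMax hΩ hθ hy))
  rw [Pi.sub_apply, Pi.smul_apply, smul_eq_mul]
  refine (abs_sub _ _).trans (add_le_add hlinear ?_)
  rw [abs_mul]
  exact mul_le_mul_of_nonneg_right hparameter (abs_nonneg _)

namespace IsTrajectory

variable {n : ℕ} {A P Q : Matrix (Fin n) (Fin n) ℝ} {b c K θ x₀ θhat₀ : Fin n → ℝ}
  {C : RatFunc ℝ} {Γc : ℝ} {Ω : Set (Fin n → ℝ)} {r : ℝ → ℝ} {x xhat θhat : ℝ → Fin n → ℝ}
  {u u₁ u₂ : ℝ → ℝ} {t : ℝ}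

lemma continuousOn_x (h : IsTrajectory A b c K C P Γc Ω θ r x₀ θhat₀ x xhat θhat u u₁ u₂) :
    ContinuousOn x (Ici 0) :=
  fun t ht => (h.x_deriv t ht).continuousWithinAt

lemma continuousOn_xhat (h : IsTrajectory A b c K C P Γc Ω θ r x₀ θhat₀ x xhat θhat u u₁ u₂) :
    ContinuousOn xhat (Ici 0) :=
  fun t ht => (h.xhat_deriv t ht).continuousWithinAt

lemma θhat_zero (h : IsTrajectory A b c K C P Γc Ω θ r x₀ θhat₀ x xhat θhat u u₁ u₂) :
    θhat 0 = θhat₀ := by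
  obtain ⟨v, -, -, hlaw⟩ := h.θhat_law
  simpa using hlaw 0 le_rfl

lemma exists_hasVelocity_θhat
    (h : IsTrajectory A b c K C P Γc Ω θ r x₀ θhat₀ x xhat θhat u u₁ u₂) :
    ∃ v : ℝ → Fin n → ℝ, HasVelocity θhat (Γc • v) ∧ ∀ᵐ t ∂volume.restrict (Ici 0),
      IsProj Ω (θhat t) (((xhat t - x t) ⬝ᵥ P *ᵥ b) • x t) (v t) := by
  obtain ⟨v, hv, hproj, hlaw⟩ := h.θhat_law
  refine ⟨v, ⟨fun T hT => (hv T hT).smul Γc, fun t ht => ?_⟩, hproj⟩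
  simp only [Pi.smul_apply]
  rw [hlaw t ht, h.θhat_zero, intervalIntegral.integral_smul]

lemma θhat_mem (h : IsTrajectory A b c K C P Γc Ω θ r x₀ θhat₀ x xhat θhat u u₁ u₂)
    (hΩ : IsClosed Ω) (hconv : Convex ℝ Ω) (hΓ : 0 ≤ Γc) (hθhat₀ : θhat₀ ∈ Ω) (ht : 0 ≤ t) :
    θhat t ∈ Ω := by
  obtain ⟨v, hv, hproj⟩ := h.exists_hasVelocity_θhat
  refine hv.mem_of_mem_tangentCone hΩ hconv (h.θhat_zero ▸ hθhat₀) ?_ ht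
  filter_upwards [hproj] with τ hτ using smul_mem_tangentCone hτ.1 hΓ

lemma continuousOn_θhat_dotProduct_x
    (h : IsTrajectory A b c K C P Γc Ω θ r x₀ θhat₀ x xhat θhat u u₁ u₂) :
    ContinuousOn (fun t => θhat t ⬝ᵥ x t) (Ici 0) := by
  obtain ⟨v, hv, -⟩ := h.exists_hasVelocity_θhat
  exact continuousOn_dotProduct hv.continuousOn h.continuousOn_x

lemma hasDerivWithinAt_error
    (h : IsTrajectory A b c K C P Γc Ω θ r x₀ θhat₀ x xhat θhat u u₁ u₂) (ht : 0 ≤ t) :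
    HasDerivWithinAt (fun t => xhat t - x t)
      (closedMatrix A b K *ᵥ (xhat t - x t) - ((θhat t - θ) ⬝ᵥ x t) • b) (Ici 0) t := by
  refine ((h.xhat_deriv t ht).sub (h.x_deriv t ht)).congr_deriv ?_
  have hplant : A *ᵥ x t = closedMatrix A b K *ᵥ x t + (K ⬝ᵥ x t) • b := by
    rw [closedMatrix, Matrix.sub_mulVec, Matrix.vecMulVec_mulVec, op_smul_eq_smul, sub_add_cancel]
  rw [h.control t ht, h.control_one t ht, hplant, Matrix.mulVec_sub, sub_dotProduct]
  module

lemma lyapunovFun_error_add_integral_le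
    (h : IsTrajectory A b c K C P Γc Ω θ r x₀ θhat₀ x xhat θhat u u₁ u₂)
    (hA : IsHurwitz (closedMatrix A b K)) (hQ : Q.PosDef)
    (hP : (closedMatrix A b K)ᵀ * P + P * closedMatrix A b K = -Q) (hΩ : Convex ℝ Ω)
    (hθ : θ ∈ Ω) (hΓ : Γc ≠ 0) {T : ℝ} (hT : 0 ≤ T) :
    lyapunovFun P Γc (xhat T - x T) (θhat T - θ)
        + ∫ t in (0 : ℝ)..T, (xhat t - x t) ⬝ᵥ Q *ᵥ (xhat t - x t)
      ≤ lyapunovFun P Γc 0 (θhat₀ - θ) := by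
  obtain ⟨v, hv, hproj⟩ := h.exists_hasVelocity_θhat
  have hdecr := lyapunovFun_add_integral_le (e := fun t => xhat t - x t)
    (hA.transpose_eq_of_lyapunov hQ.isHermitian.eq hP) hP hΩ hθ hΓ h.continuousOn_x
    (fun t ht => h.hasDerivWithinAt_error ht) hv hproj hT
  rwa [h.xhat_zero, h.x_zero, sub_self, h.θhat_zero] at hdecr

lemma exists_norm_error_le
    (h : IsTrajectory A b c K C P Γc Ω θ r x₀ θhat₀ x xhat θhat u u₁ u₂)
    (hA : IsHurwitz (closedMatrix A b K)) (hQ : Q.PosDef)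
    (hP : (closedMatrix A b K)ᵀ * P + P * closedMatrix A b K = -Q) (hΩ : Convex ℝ Ω)
    (hθ : θ ∈ Ω) (hΓ : 0 < Γc) : ∃ E, ∀ t, 0 ≤ t → ‖xhat t - x t‖ ≤ E := by
  obtain ⟨m, hm, hmP⟩ := exists_mul_norm_sq_le_of_posDef (hA.posDef_of_lyapunov hQ hP)
  refine ⟨√(lyapunovFun P Γc 0 (θhat₀ - θ) / m), fun t ht => Real.le_sqrt_of_sq_le ?_⟩
  have hdissipated : 0 ≤ ∫ τ in (0 : ℝ)..t, (xhat τ - x τ) ⬝ᵥ Q *ᵥ (xhat τ - x τ) :=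
    intervalIntegral.integral_nonneg ht fun τ _ => hQ.posSemidef.dotProduct_mulVec_nonneg _
  rw [le_div_iff₀' hm]
  linarith [hmP (xhat t - x t),
    dotProduct_mulVec_le_lyapunovFun P hΓ.le (xhat t - x t) (θhat t - θ),
    h.lyapunovFun_error_add_integral_le hA hQ hP hΩ hθ hΓ.ne' ht]

lemma integrableOn_norm_error_sq
    (h : IsTrajectory A b c K C P Γc Ω θ r x₀ θhat₀ x xhat θhat u u₁ u₂)
    (hA : IsHurwitz (closedMatrix A b K)) (hQ : Q.PosDef)
    (hP : (closedMatrix A b K)ᵀ * P + P * closedMatrix A b K = -Q) (hΩ : Convex ℝ Ω)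
    (hθ : θ ∈ Ω) (hΓ : 0 < Γc) : IntegrableOn (fun t => ‖xhat t - x t‖ ^ 2) (Ioi 0) := by
  have hec : ContinuousOn (fun t => xhat t - x t) (Ici 0) :=
    h.continuousOn_xhat.sub h.continuousOn_x
  have hQint : IntegrableOn (fun t => (xhat t - x t) ⬝ᵥ Q *ᵥ (xhat t - x t)) (Ioi 0) := by
    refine integrableOn_Ioi_of_integral_le (I := lyapunovFun P Γc 0 (θhat₀ - θ))
      (continuousOn_dotProduct hec (continuousOn_mulVec Q hec))
      (fun t _ => hQ.posSemidef.dotProduct_mulVec_nonneg _) fun T hT => ?_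
    have hV : 0 ≤ lyapunovFun P Γc (xhat T - x T) (θhat T - θ) :=
      ((hA.posDef_of_lyapunov hQ hP).posSemidef.dotProduct_mulVec_nonneg _).trans
        (dotProduct_mulVec_le_lyapunovFun P hΓ.le _ _)
    linarith [h.lyapunovFun_error_add_integral_le hA hQ hP hΩ hθ hΓ.ne' hT]
  obtain ⟨k, hk, hkQ⟩ := exists_mul_norm_sq_le_of_posDef hQ
  refine (hQint.const_mul k⁻¹).mono'
    (((hec.norm.pow 2).mono Ioi_subset_Ici_self).aestronglyMeasurable measurableSet_Ioi)
    (.of_forall fun t => ?_)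
  rw [Real.norm_of_nonneg (sq_nonneg _), le_inv_mul_iff₀ hk]
  exact hkQ (xhat t - x t)

lemma xhat_apply_eq (h : IsTrajectory A b c K C P Γc Ω θ r x₀ θhat₀ x xhat θhat u u₁ u₂)
    (hA : IsHurwitz (closedMatrix A b K)) (hC : HasStableResponse C)
    (hr : ContinuousOn r (Ici 0)) (i : Fin n) (ht : 0 ≤ t) :
    xhat t i = flow (closedMatrix A b K) x₀ t i
      + response (Gbar (closedMatrix A b K) b C i 0) (fun τ => θhat τ ⬝ᵥ x τ) t
      + response (Ho (closedMatrix A b K) b i * C)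
          (fun τ => 1 / dcGain (closedMatrix A b K) b c * r τ) t := by
  rw [← h.xhat_zero]
  refine predictor_apply_eq hA hC h.continuousOn_θhat_dotProduct_x (hr.const_mul _)
    (fun t ht => (h.xhat_deriv t ht).congr_deriv ?_) i ht
  rw [h.control_two t ht, sub_smul, ← add_sub_assoc, sub_add_eq_add_sub]
  rfl

lemma exists_norm_xhat_le (h : IsTrajectory A b c K C P Γc Ω θ r x₀ θhat₀ x xhat θhat u u₁ u₂)
    (hA : IsHurwitz (closedMatrix A b K)) (hC : HasStableResponse C)
    (hr : ContinuousOn r (Ici 0)) {R : ℝ} (hR : ∀ t, 0 ≤ t → |r t| ≤ R) (hΩ : IsCompact Ω)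
    (hconv : Convex ℝ Ω) (hΓ : 0 ≤ Γc) (hθhat₀ : θhat₀ ∈ Ω)
    (hgain : l1Gain (Gbar (closedMatrix A b K) b C) * ENNReal.ofReal (thetaMax Ω) < 1)
    {E : ℝ} (hE : ∀ t, 0 ≤ t → ‖xhat t - x t‖ ≤ E) : ∃ M, ∀ t, 0 ≤ t → ‖xhat t‖ ≤ M := by
  set Am := closedMatrix A b K
  set q := (l1Gain (Gbar Am b C) * ENNReal.ofReal (thetaMax Ω)).toReal with hq
  have hq1 : q < 1 := by simpa [hq] using ENNReal.toReal_strict_mono ENNReal.one_ne_top hgain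
  have href (τ : ℝ) (hτ : 0 ≤ τ) : |1 / dcGain Am b c * r τ| ≤ |1 / dcGain Am b c| * R := by
    rw [abs_mul]
    exact mul_le_mul_of_nonneg_left (hR τ hτ) (abs_nonneg _)
  choose N hN using fun i : Fin n => exists_abs_flow_add_response_le hA
    ((hA.hasStableResponse_Ho (b := b) (i := i)).mul hC) href x₀ i
  have hN0 (i : Fin n) : 0 ≤ N i := (abs_nonneg _).trans (hN i 0 le_rfl)
  have hE0 : 0 ≤ E := (norm_nonneg _).trans (hE 0 le_rfl)
  refine ⟨(∑ i, N i + q * E) / (1 - q), fun t ht =>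
    norm_le_of_small_gain h.continuousOn_xhat hq1 (fun t ht B hB => ?_) ht⟩
  have hB0 : 0 ≤ B := (norm_nonneg _).trans (hB 0 ⟨le_rfl, ht⟩)
  have hx (τ : ℝ) (hτ : τ ∈ Icc 0 t) : ‖x τ‖ ≤ B + E := by
    rw [← sub_sub_cancel (xhat τ) (x τ)]
    exact (norm_sub_le _ _).trans (add_le_add (hB τ hτ) (hE τ hτ.1))
  have hsum (i : Fin n) : N i ≤ ∑ i, N i :=
    Finset.single_le_sum (fun i _ => hN0 i) (Finset.mem_univ i)
  have hq0 : 0 ≤ q := ENNReal.toReal_nonneg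
  have hN_sum : 0 ≤ ∑ i, N i := Finset.sum_nonneg fun i _ => hN0 i
  refine (pi_norm_le_iff_of_nonneg (add_nonneg (add_nonneg hN_sum (mul_nonneg hq0 hE0))
    (mul_nonneg hq0 hB0))).2 fun i => ?_
  have hfeedback := abs_response_dotProduct_le (hasStableResponse_Gbar hA hC i 0) hΩ
    hgain.ne_top ht (fun τ hτ => h.θhat_mem hΩ.isClosed hconv hΓ hθhat₀ hτ.1) hx
  rw [h.xhat_apply_eq hA hC hr i ht, add_right_comm]
  refine (norm_add_le _ _).trans ((add_le_add ((hN i t ht).trans (hsum i)) hfeedback).trans_eq ?_)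
  ring

lemma tendsto_error (h : IsTrajectory A b c K C P Γc Ω θ r x₀ θhat₀ x xhat θhat u u₁ u₂)
    (hΩ : IsCompact Ω) (hconv : Convex ℝ Ω) (hΓ : 0 ≤ Γc) (hθhat₀ : θhat₀ ∈ Ω) (hθ : θ ∈ Ω)
    {E M : ℝ} (hE : ∀ t, 0 ≤ t → ‖xhat t - x t‖ ≤ E) (hM : ∀ t, 0 ≤ t → ‖x t‖ ≤ M)
    (hsq : IntegrableOn (fun t => ‖xhat t - x t‖ ^ 2) (Ioi 0)) :
    Tendsto (fun t => xhat t - x t) atTop (𝓝 0) := by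
  refine tendsto_pi_nhds.2 fun i => ?_
  refine tendsto_zero_of_integrableOn_sq
    (fun t ht => hasDerivWithinAt_pi.1 (h.hasDerivWithinAt_error ht) i)
    (fun t ht => (norm_le_pi_norm (xhat t - x t) i).trans (hE t ht))
    (fun t ht => abs_error_deriv_le hΩ (h.θhat_mem hΩ.isClosed hconv hΓ hθhat₀ ht) hθ
      (hE t ht) (hM t ht) i) ?_
  have hei : ContinuousOn (fun t => (xhat t - x t) i) (Ici 0) :=
    continuousOn_pi.1 (h.continuousOn_xhat.sub h.continuousOn_x) i
  refine hsq.mono' (((hei.pow 2).mono Ioi_subset_Ici_self).aestronglyMeasurable measurableSet_Ioi)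
    (.of_forall fun t => ?_)
  rw [norm_pow]
  gcongr
  exact norm_le_pi_norm (xhat t - x t) i

end IsTrajectory

end L1Adaptive

end

open L1Adaptive Matrix Set Filter Topology in
theorem theorem1_general {n : ℕ} {A P Q : Matrix (Fin n) (Fin n) ℝ}
    {b c K θ x₀ θhat₀ : Fin n → ℝ} {Ω : Set (Fin n → ℝ)} (hΩ_compact : IsCompact Ω)
    (hΩ_convex : Convex ℝ Ω) (hθ : θ ∈ Ω) {r : ℝ → ℝ} (hr_cont : ContinuousOn r (Ici 0))
    (hr_bdd : ∃ R : ℝ, ∀ t, 0 ≤ t → |r t| ≤ R) (hK : IsHurwitz (closedMatrix A b K))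
    (_hdc : dcGain (closedMatrix A b K) b c ≠ 0) {C : RatFunc ℝ} (hC_stable : IsStable C)
    (hC_proper : IsStrictlyProper C) (hQ : Q.PosDef)
    (hP : (closedMatrix A b K)ᵀ * P + P * closedMatrix A b K = -Q) {Γc : ℝ} (hΓ : 0 < Γc)
    (hgain : l1Gain (Gbar (closedMatrix A b K) b C) * ENNReal.ofReal (thetaMax Ω) < 1)
    (hθhat₀ : θhat₀ ∈ Ω) {x xhat θhat : ℝ → Fin n → ℝ} {u u₁ u₂ : ℝ → ℝ}
    (htraj : IsTrajectory A b c K C P Γc Ω θ r x₀ θhat₀ x xhat θhat u u₁ u₂) :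
    (∃ M : ℝ, ∀ t, 0 ≤ t → ‖xhat t‖ ≤ M) ∧ (∃ M : ℝ, ∀ t, 0 ≤ t → ‖x t‖ ≤ M) ∧
      Tendsto (fun t => xhat t - x t) atTop (𝓝 0) := by
  obtain ⟨R, hR⟩ := hr_bdd
  obtain ⟨E, hE⟩ := htraj.exists_norm_error_le hK hQ hP hΩ_convex hθ hΓ
  obtain ⟨M, hM⟩ := htraj.exists_norm_xhat_le hK
    (hasStableResponse_of_isStable hC_stable hC_proper) hr_cont hR hΩ_compact hΩ_convex hΓ.le
    hθhat₀ hgain hE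
  have hx (t : ℝ) (ht : 0 ≤ t) : ‖x t‖ ≤ M + E := by
    rw [← sub_sub_cancel (xhat t) (x t)]
    exact (norm_sub_le _ _).trans (add_le_add (hM t ht) (hE t ht))
  exact ⟨⟨M, hM⟩, ⟨M + E, hx⟩, htraj.tendsto_error hΩ_compact hΩ_convex hΓ.le hθhat₀ hθ hE hx
    (htraj.integrableOn_norm_error_sq hK hQ hP hΩ_convex hθ hΓ)⟩

theorem theorem1 {n : ℕ}
    (A : Matrix (Fin n) (Fin n) ℝ) (b c : Fin n → ℝ)
    (hAb : L1Adaptive.IsControllable A b)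
    (Ω : Set (Fin n → ℝ)) (hΩ_compact : IsCompact Ω) (hΩ_convex : Convex ℝ Ω)
    (θ : Fin n → ℝ) (hθ : θ ∈ Ω)
    (r : ℝ → ℝ) (hr_cont : ContinuousOn r (Set.Ici 0))
    (hr_bdd : ∃ R : ℝ, ∀ t, 0 ≤ t → |r t| ≤ R)
    (K : Fin n → ℝ) (hK : L1Adaptive.IsHurwitz (L1Adaptive.closedMatrix A b K))
    (hdc : L1Adaptive.dcGain (L1Adaptive.closedMatrix A b K) b c ≠ 0)
    (C : RatFunc ℝ) (hC_stable : L1Adaptive.IsStable C)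
    (hC_proper : L1Adaptive.IsStrictlyProper C)
    (hC_zero : C.eval (RingHom.id ℝ) 0 = 1)
    (P Q : Matrix (Fin n) (Fin n) ℝ) (hQ : Q.PosDef)
    (hP : (L1Adaptive.closedMatrix A b K).transpose * P
      + P * L1Adaptive.closedMatrix A b K = -Q)
    (Γc : ℝ) (hΓ : 0 < Γc)
    (hgain : L1Adaptive.l1Gain (L1Adaptive.Gbar (L1Adaptive.closedMatrix A b K) b C)
      * ENNReal.ofReal (L1Adaptive.thetaMax Ω) < 1)
    (x₀ θhat₀ : Fin n → ℝ) (hθhat₀ : θhat₀ ∈ Ω)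
    (x xhat θhat : ℝ → Fin n → ℝ) (u u₁ u₂ : ℝ → ℝ)
    (htraj : L1Adaptive.IsTrajectory A b c K C P Γc Ω θ r x₀ θhat₀ x xhat θhat u u₁ u₂) :
    (∃ M : ℝ, ∀ t, 0 ≤ t → ‖xhat t‖ ≤ M) ∧
    (∃ M : ℝ, ∀ t, 0 ≤ t → ‖x t‖ ≤ M) ∧
    Filter.Tendsto (fun t => xhat t - x t) Filter.atTop (nhds 0) :=
  theorem1_general hΩ_compact hΩ_convex hθ hr_cont hr_bdd hK hdc hC_stable hC_proper hQ hP
    hΓ hgain hθhat₀ htraj
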